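/- Let $\alpha,k,T,s,K,c,L>0$, $0<\gamma\le 1$, and $y_0,r\in\mathbb{R}$. There is a constant $D>0$, depending only on these parameters, such that the following holds. Let $\sigma:\mathbb{R}\to\mathbb{R}$ satisfy $\sigma(x)\ge c$ and $|\sigma^2(x)-\sigma^2(y)|\le L|x-y|^\gamma$ for all $x,y\in\mathbb{R}$. On a probability space $(\Omega,\mathcal{F},\mathbb{Q})$ let $B$ and $Z$ be independent Wiener processes, let $Y$ be the Ornstein–Uhlenbeck process, i.e. the continuous solution on $[0,T]$ of $$dY_t=-\alpha Y_t\,dt+k\,dZ_t,\qquad Y_0=y_0,$$ and let $S$ be the solution of $dS_t=rS_t\,dt+\sigma(Y_t)S_t\,dB_t$, $S_0=s$, i.e. $$S_t=s\exp\Bigl(rt-\tfrac12\int_0^t\sigma^2(Y_u)\,du+\int_0^t\sigma(Y_u)\,dB_u\Bigr),\qquad 0\le t\le T.$$ Let $P:=\mathbb{E}^{\mathbb{Q}}\{(S_T-K)^+\mid Y_t,\ 0\le t\le T\}$ be the conditional (undiscounted) call price, let $\Phi$ be the standard normal distribution function, and for $v>0$ put $$\mathrm{BS}(v)=e^{\ln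 s+rT}\,\Phi\Bigl(\frac{\ln s+(r+\frac12v^2)T-\ln K}{v\sqrt T}\Bigr)-K\,\Phi\Bigl(\frac{\ln s+(r-\frac12v^2)T-\ln K}{v\sqrt T}\Bigr).$$ For $m\ge1$ let $Y^{(m)}$ be the Euler–Maruyama scheme $$Y^{(m)}_0=y_0,\qquad Y^{(m)}_{l+1}=\Bigl(1-\alpha\frac Tm\Bigr)Y^{(m)}_l+k\bigl(Z_{(l+1)T/m}-Z_{lT/m}\bigr),\quad 0\le l\le m-1,$$ and put $$\bar\sigma=\sqrt{\frac1T\int_0^T\sigma^2(Y_u)\,du},\qquad \bar\sigma_m=\sqrt{\frac1m\sum_{l=1}^m\sigma^2\bigl(Y^{(m)}_l\bigr)},\qquad \hat P_m=\mathrm{BS}(\bar\sigma_m).$$ Then $P=\mathrm{BS}(\bar\sigma)$ almost surely, and for every $m\ge1$ the variable $P-\hat P_m$ is integrable and $$\mathbb{E}^{\mathbb{Q}}|P-\hat P_m|\le D\,m^{-\gamma/2}.$$ -/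

import Mathlib

open MeasureTheory ProbabilityTheory
open scoped NNReal

namespace StochVol

noncomputable section

/-- `I` is the Itô integral `∫₀ᵗ H dB` of a process `H` with almost surely continuous paths: the
limit in probability of the left-endpoint Riemann sums over the uniform partitions of `[0, t]`. -/
def IsItoIntegral {Ω : Type*} [MeasurableSpace Ω] (Q : Measure Ω) (H B : ℝ≥0 → Ω → ℝ)
    (t : ℝ≥0) (I : Ω → ℝ) : Prop :=
  TendstoInMeasure Q
    (fun (n : ℕ) (ω : Ω) ↦ ∑ i ∈ Finset.range n,
      H ((i : ℝ≥0) * t / n) ω *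
        (B (((i : ℝ≥0) + 1) * t / n) ω - B ((i : ℝ≥0) * t / n) ω))
    Filter.atTop I

/-- On `[0, T]` the process `Y` is a continuous solution of `dY = -α Y dt + k dZ`, `Y₀ = y₀`,
that is, `Yₜ = y₀ - α ∫₀ᵗ Yₛ ds + k Zₜ`. -/
structure IsOrnsteinUhlenbeck {Ω : Type*} [MeasurableSpace Ω] (Q : Measure Ω)
    (α k y₀ : ℝ) (T : ℝ≥0) (Z Y : ℝ≥0 → Ω → ℝ) : Prop where
  measurable : ∀ t, Measurable (Y t)
  continuousOn : ∀ᵐ ω ∂Q, ContinuousOn (fun t ↦ Y t ω) (Set.Iic T)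
  sde : ∀ᵐ ω ∂Q, ∀ t ≤ T,
    Y t ω = y₀ - α * (∫ u in (0 : ℝ)..t, Y u.toNNReal ω) + k * Z t ω

/-- On `[0, T]` the process `S` is the solution of `dS = r S dt + σ(Y) S dB`, `S₀ = s`, that is,
`Sₜ = s exp (r t - (1/2) ∫₀ᵗ σ²(Yᵤ) du + ∫₀ᵗ σ(Yᵤ) dBᵤ)` almost surely. -/
structure IsAssetPrice {Ω : Type*} [MeasurableSpace Ω] (Q : Measure Ω)
    (r s : ℝ) (σ : ℝ → ℝ) (T : ℝ≥0) (B Y S : ℝ≥0 → Ω → ℝ) : Prop where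
  measurable : ∀ t, Measurable (S t)
  solution : ∀ t ≤ T, ∃ I : Ω → ℝ,
    IsItoIntegral Q (fun u ω ↦ σ (Y u ω)) B t I ∧
    ∀ᵐ ω ∂Q, S t ω =
      s * Real.exp (r * t - 1 / 2 * (∫ u in (0 : ℝ)..t, σ (Y u.toNNReal ω) ^ 2) + I ω)

/-- The risk-neutral market model on the probability space `(Ω, Q)`: independent Wiener processes
`B` and `Z`, the Ornstein-Uhlenbeck process `Y` driven by `Z`, and the asset price `S`. -/
structure IsMarketModel {Ω : Type*} [MeasurableSpace Ω] (Q : Measure Ω)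
    (α k y₀ r s : ℝ) (σ : ℝ → ℝ) (T : ℝ≥0) (B Z Y S : ℝ≥0 → Ω → ℝ) : Prop where
  measurable_B : ∀ t, Measurable (B t)
  measurable_Z : ∀ t, Measurable (Z t)
  brownian_B : IsBrownianReal B Q
  brownian_Z : IsBrownianReal Z Q
  indep : IndepFun (fun ω t ↦ B t ω) (fun ω t ↦ Z t ω) Q
  volatility : IsOrnsteinUhlenbeck Q α k y₀ T Z Y
  asset : IsAssetPrice Q r s σ T B Y S

/-- The sigma-algebra generated by `Yₜ`, `0 ≤ t ≤ T`. -/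
abbrev pathSigma {Ω : Type*} (Y : ℝ≥0 → Ω → ℝ) (T : ℝ≥0) : MeasurableSpace Ω :=
  ⨆ t : Set.Iic T, MeasurableSpace.comap (Y t) inferInstance

/-- `P`: the conditional expectation of the call payoff `(S_T - K)⁺` given `Yₜ`, `0 ≤ t ≤ T`. -/
def conditionalPrice {Ω : Type*} [MeasurableSpace Ω] (Q : Measure Ω) (K : ℝ) (T : ℝ≥0)
    (Y S : ℝ≥0 → Ω → ℝ) : Ω → ℝ :=
  Q[fun ω ↦ max (S T ω - K) 0 | pathSigma Y T]

/-- The standard normal distribution function. -/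
def Phi (x : ℝ) : ℝ := cdf (gaussianReal 0 1) x

/-- The (undiscounted) Black-Scholes call price with volatility `v`. -/
def blackScholes (s K r T v : ℝ) : ℝ :=
  Real.exp (Real.log s + r * T) *
      Phi ((Real.log s + (r + 1 / 2 * v ^ 2) * T - Real.log K) / (v * √T)) -
    K * Phi ((Real.log s + (r - 1 / 2 * v ^ 2) * T - Real.log K) / (v * √T))

/-- The averaged volatility `√((1/T) ∫₀ᵀ σ²(Yᵤ) du)`. -/
def avgVol {Ω : Type*} (σ : ℝ → ℝ) (T : ℝ≥0) (Y : ℝ≥0 → Ω → ℝ) (ω : Ω) : ℝ :=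
  √(1 / (T : ℝ) * ∫ u in (0 : ℝ)..T, σ (Y u.toNNReal ω) ^ 2)

/-- The Euler-Maruyama scheme with `m` steps on `[0, T]`: `eulerOU α k y₀ T Z m l` is the value
at time `l T / m`. -/
def eulerOU {Ω : Type*} (α k y₀ : ℝ) (T : ℝ≥0) (Z : ℝ≥0 → Ω → ℝ) (m : ℕ) : ℕ → Ω → ℝ
  | 0, _ => y₀
  | l + 1, ω => (1 - α * ((T : ℝ) / m)) * eulerOU α k y₀ T Z m l ω +
      k * (Z (((l : ℝ≥0) + 1) * T / m) ω - Z ((l : ℝ≥0) * T / m) ω)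

/-- The averaged discretized volatility `√((1/m) ∑_{l=1}^m σ²(Y^{(m)}_l))`. -/
def avgVolEuler {Ω : Type*} (α k y₀ : ℝ) (σ : ℝ → ℝ) (T : ℝ≥0) (Z : ℝ≥0 → Ω → ℝ) (m : ℕ)
    (ω : Ω) : ℝ :=
  √(1 / (m : ℝ) * ∑ l ∈ Finset.Icc 1 m, σ (eulerOU α k y₀ T Z m l ω) ^ 2)

/-- The discretized price: the Black-Scholes price with the averaged discretized volatility. -/
def discretePrice {Ω : Type*} (α k y₀ r s K : ℝ) (σ : ℝ → ℝ) (T : ℝ≥0) (Z : ℝ≥0 → Ω → ℝ)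
    (m : ℕ) (ω : Ω) : ℝ :=
  blackScholes s K r T (avgVolEuler α k y₀ σ T Z m ω)

end

end StochVol

/-!
Conditionally on the volatility path `(Yₜ)`, the log-price is Gaussian, so the conditional call
price is the Black-Scholes price at the averaged volatility; the rate then comes from the Lipschitz
continuity of the Black-Scholes price in the volatility and from the strong error of the
Euler-Maruyama scheme.

*The conditional price.* Solving the equation for `Y` by variation of constants exhibits every `Yₜ`
as an almost sure limit of measurable functionals of `Z`, so the path of `Y` is independent of `B`
(`IsOrnsteinUhlenbeck.indepFun`). A left-endpoint Riemann sum of `∫ σ(Y) dB`, divided by the square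
root of the corresponding Riemann sum of `∫ σ²(Y) dt`, is a combination of increments of `B`
normalised by the path of `Y`; it is therefore exactly standard Gaussian and independent of that
path. Characteristic functions on the events of the path carry this property over to the limit
`G = ∫ σ(Y) dB / √(∫ σ²(Y) dt)` (`map_prodMk_eq_prod_gaussianReal_of_tendsto`). The asset price is
an explicit function of the integrated variance and of `G`, and integrating out `G` is the
Black-Scholes formula (`integral_callPayoff`, `condExp_callPayoff_ae_eq`).

*The error.* The vega is `s e^{rT} √T φ(d₁)`, hence bounded (`abs_blackScholes_sub_le`), and since
both averaged volatilities are at least `c`, the pricing error is at most a constant times the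
difference of their squares. By the Hölder condition this is controlled by the mean of
`|Yᵤ - Y^{(m)}_l| ^ γ` for `u` in the `l`-th cell of the partition. The mean of `|Yᵤ - Y^{(m)}_l|`
itself is of order `√(T / m)`, by a discrete Gronwall argument
(`IsOrnsteinUhlenbeck.integral_abs_sub_eulerOU_le`). The inequality `x ^ γ ≤ δ ^ γ + δ ^ (γ - 1) x`
with `δ = √(T / m)` turns this into the rate `m ^ (-γ / 2)`.
-/

namespace StochVol

open Filter Topology

/-! ### The Black-Scholes formula and its vega -/

lemma Phi_eq_setIntegral (x : ℝ) : Phi x = ∫ u in Set.Iic x, gaussianPDFReal 0 1 u := by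
  rw [Phi, cdf_eq_real, measureReal_def, gaussianReal_apply_eq_integral 0 one_ne_zero,
    ENNReal.toReal_ofReal]
  exact integral_nonneg fun u ↦ gaussianPDFReal_nonneg 0 1 u

lemma gaussianPDFReal_zero_one_neg (x : ℝ) :
    gaussianPDFReal 0 1 (-x) = gaussianPDFReal 0 1 x := by
  simp [gaussianPDFReal]

lemma gaussianPDFReal_zero_one_le_one (x : ℝ) : gaussianPDFReal 0 1 x ≤ 1 := by
  rw [gaussianPDFReal]
  have h1 : (1 : ℝ) ≤ √(2 * Real.pi * ((1 : ℝ≥0) : ℝ)) := by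
    rw [Real.one_le_sqrt]
    have := Real.pi_gt_three
    push_cast
    linarith
  have h2 : Real.exp (-(x - 0) ^ 2 / (2 * ((1 : ℝ≥0) : ℝ))) ≤ 1 := by
    rw [Real.exp_le_one_iff]
    push_cast
    nlinarith [sq_nonneg (x - 0)]
  exact mul_le_one₀ (inv_le_one_of_one_le₀ h1) (Real.exp_pos _).le h2

lemma continuous_gaussianPDFReal_zero_one : Continuous (gaussianPDFReal 0 1) := by
  unfold gaussianPDFReal
  fun_prop

lemma setIntegral_Ioi_gaussianPDFReal (x : ℝ) :
    ∫ u in Set.Ioi (-x), gaussianPDFReal 0 1 u = Phi x := by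
  rw [Phi_eq_setIntegral, ← integral_comp_neg_Iic]
  simp_rw [gaussianPDFReal_zero_one_neg]

lemma hasDerivAt_Phi (x : ℝ) : HasDerivAt Phi (gaussianPDFReal 0 1 x) x := by
  have hc := continuous_gaussianPDFReal_zero_one
  have hi := integrable_gaussianPDFReal 0 1
  have h : Phi = fun y ↦ Phi x + ∫ u in x..y, gaussianPDFReal 0 1 u := by
    funext y
    rw [Phi_eq_setIntegral, Phi_eq_setIntegral,
      ← intervalIntegral.integral_Iic_sub_Iic hi.integrableOn hi.integrableOn]
    ring
  rw [h]
  exact (intervalIntegral.integral_hasDerivAt_right (hc.intervalIntegrable _ _)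
    hc.stronglyMeasurable.stronglyMeasurableAtFilter hc.continuousAt).const_add _

/-- The exponential tilt of the standard normal density is its translate. -/
lemma gaussianPDFReal_mul_exp (a g : ℝ) :
    gaussianPDFReal 0 1 g * Real.exp (a * g - a ^ 2 / 2) = gaussianPDFReal 0 1 (g - a) := by
  simp only [gaussianPDFReal]
  rw [mul_assoc, ← Real.exp_add]
  congr 2
  push_cast
  ring

lemma measurable_Phi : Measurable Phi :=
  (monotone_cdf (gaussianReal 0 1)).measurable

lemma measurable_blackScholes (s K r T : ℝ) : Measurable (blackScholes s K r T) := by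
  have := measurable_Phi
  unfold blackScholes
  fun_prop

lemma norm_blackScholes_le (s : ℝ) {K : ℝ} (r T v : ℝ) (hK : 0 < K) :
    ‖blackScholes s K r T v‖ ≤ Real.exp (Real.log s + r * T) + K := by
  have h0 := fun x ↦ cdf_nonneg (gaussianReal 0 1) x
  have h1 := fun x ↦ cdf_le_one (gaussianReal 0 1) x
  unfold blackScholes Phi
  set F := Real.exp (Real.log s + r * T)
  have hF : 0 < F := Real.exp_pos _
  rw [Real.norm_eq_abs]
  refine (abs_sub _ _).trans (add_le_add ?_ ?_)
  · rw [abs_of_nonneg (mul_nonneg hF.le (h0 _))]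
    exact mul_le_of_le_one_right hF.le (h1 _)
  · rw [abs_of_nonneg (mul_nonneg hK.le (h0 _))]
    exact mul_le_of_le_one_right hK.le (h1 _)

/-- The vega of the Black-Scholes price: the two terms coming from the derivatives of the moneyness
cancel because `F φ(d₁) = K φ(d₂)`. -/
lemma hasDerivAt_blackScholes (s : ℝ) {K : ℝ} (r : ℝ) {T v : ℝ} (hK : 0 < K) (hT : 0 < T)
    (hv : 0 < v) :
    HasDerivAt (blackScholes s K r T)
      (Real.exp (Real.log s + r * T) * √T *
        gaussianPDFReal 0 1
          ((Real.log s + (r + 1 / 2 * v ^ 2) * T - Real.log K) / (v * √T))) v := by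
  have hq : 0 < √T := Real.sqrt_pos.2 hT
  have hqq : √T ^ 2 = T := Real.sq_sqrt hT.le
  set q := √T with hqdef
  set d1 := (Real.log s + (r + 1 / 2 * v ^ 2) * T - Real.log K) / (v * q) with hd1
  set d2 := (Real.log s + (r - 1 / 2 * v ^ 2) * T - Real.log K) / (v * q) with hd2
  have key : Real.exp (Real.log s + r * T) * gaussianPDFReal 0 1 d1
      = K * gaussianPDFReal 0 1 d2 := by
    simp only [gaussianPDFReal]
    have h2 : d1 = d2 + v * q := by
      rw [hd1, hd2, ← hqq]
      field_simp
      ring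
    have h3 : d2 * (v * q) = Real.log s + (r - 1 / 2 * v ^ 2) * T - Real.log K := by
      rw [hd2]
      field_simp
    have h4 : Real.log s + r * T + -(d1 - 0) ^ 2 / (2 * ((1 : ℝ≥0) : ℝ))
        = Real.log K + -(d2 - 0) ^ 2 / (2 * ((1 : ℝ≥0) : ℝ)) := by
      rw [h2]
      push_cast
      have h5 : (v * q) ^ 2 = v ^ 2 * T := by rw [mul_pow, hqq]
      linear_combination -h3 - h5 / 2
    have h6 : Real.exp (Real.log s + r * T)
        * Real.exp (-(d1 - 0) ^ 2 / (2 * ((1 : ℝ≥0) : ℝ)))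
        = K * Real.exp (-(d2 - 0) ^ 2 / (2 * ((1 : ℝ≥0) : ℝ))) := by
      rw [← Real.exp_add, h4, Real.exp_add, Real.exp_log hK]
    linear_combination (√(2 * Real.pi * ((1 : ℝ≥0) : ℝ)))⁻¹ * h6
  have hd (e : ℝ) : HasDerivAt
      (fun v : ℝ ↦ (Real.log s + (r + e * v ^ 2) * T - Real.log K) / (v * q))
      (((e * (2 * v)) * T * (v * q)
        - (Real.log s + (r + e * v ^ 2) * T - Real.log K) * q) / (v * q) ^ 2) v := by
    have hp : HasDerivAt (fun v : ℝ ↦ v ^ 2) (2 * v) v := by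
      simpa using hasDerivAt_pow 2 v
    have hn := ((((hp.const_mul e).const_add r).mul_const T).const_add
      (Real.log s)).sub_const (Real.log K)
    have hm : HasDerivAt (fun v : ℝ ↦ v * q) q v := by
      simpa using (hasDerivAt_id v).mul_const q
    exact hn.div hm (by positivity)
  have e1 := ((hasDerivAt_Phi d1).comp v (hd (1 / 2))).const_mul (Real.exp (Real.log s + r * T))
  have hd2' := hd (-(1 / 2))
  simp only [neg_mul, ← sub_eq_add_neg] at hd2'
  have e2 := ((hasDerivAt_Phi d2).comp v hd2').const_mul K
  have e3 := e1.sub e2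
  refine e3.congr_deriv ?_
  have hX : ((1 / 2 * (2 * v)) * T * (v * q)
        - (Real.log s + (r + 1 / 2 * v ^ 2) * T - Real.log K) * q) / (v * q) ^ 2
      - (-(1 / 2 * (2 * v) * T * (v * q))
        - (Real.log s + (r - 1 / 2 * v ^ 2) * T - Real.log K) * q) / (v * q) ^ 2 = q := by
    rw [← hqq]
    field_simp
    ring
  linear_combination
    ((-(1 / 2 * (2 * v) * T * (v * q))
        - (Real.log s + (r - 1 / 2 * v ^ 2) * T - Real.log K) * q) / (v * q) ^ 2) * key
      + Real.exp (Real.log s + r * T) * gaussianPDFReal 0 1 d1 * hX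

lemma abs_blackScholes_sub_le (s : ℝ) {K : ℝ} (r : ℝ) {T v w : ℝ} (hK : 0 < K) (hT : 0 < T)
    (hv : 0 < v) (hw : 0 < w) :
    |blackScholes s K r T v - blackScholes s K r T w| ≤
      Real.exp (Real.log s + r * T) * √T * |v - w| := by
  have := (convex_Ioi (0 : ℝ)).norm_image_sub_le_of_norm_hasDerivWithin_le
    (f := blackScholes s K r T) (C := Real.exp (Real.log s + r * T) * √T)
    (fun x hx ↦ (hasDerivAt_blackScholes s r hK hT hx).hasDerivWithinAt) (fun x _ ↦ ?_) hw hv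
  · exact this
  · rw [Real.norm_of_nonneg (mul_nonneg (by positivity) (gaussianPDFReal_nonneg 0 1 _))]
    exact mul_le_of_le_one_right (by positivity) (gaussianPDFReal_zero_one_le_one _)

/-- The call payoff when the integrated variance is `v` and the normalised stochastic integral
takes the value `g`. -/
noncomputable def callPayoff (s K r T v g : ℝ) : ℝ :=
  max (s * Real.exp (r * T - 1 / 2 * v + √v * g) - K) 0

lemma measurable_callPayoff (s K r T : ℝ) :
    Measurable fun p : ℝ × ℝ ↦ callPayoff s K r T p.1 p.2 := by
  unfold callPayoff
  fun_prop

lemma callPayoff_nonneg (s K r T v g : ℝ) : 0 ≤ callPayoff s K r T v g := le_max_right _ _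

/-- The Black-Scholes formula: the payoff is nonzero exactly on the half-line `g > -d₂`, and there
the exponential factor shifts the normal density by `√v = d₁ - d₂`. -/
lemma integral_callPayoff {s K : ℝ} (r : ℝ) {T v : ℝ} (hs : 0 < s) (hK : 0 < K) (hT : 0 < T)
    (hv : 0 < v) :
    ∫ g, callPayoff s K r T v g ∂(gaussianReal 0 1) = blackScholes s K r T √(1 / T * v) := by
  set a := √v with ha
  have ha0 : 0 < a := Real.sqrt_pos.2 hv
  have haa : a ^ 2 = v := Real.sq_sqrt hv.le
  set F := Real.exp (Real.log s + r * T) with hF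
  set d2 := (Real.log s + r * T - v / 2 - Real.log K) / a with hd2
  have hi := integrable_gaussianPDFReal 0 1
  have hexp (g : ℝ) : s * Real.exp (r * T - 1 / 2 * v + a * g)
      = F * Real.exp (a * g - a ^ 2 / 2) := by
    rw [hF, Real.exp_add (Real.log s), Real.exp_log hs, mul_assoc, ← Real.exp_add, haa]
    ring_nf
  have hpay (g : ℝ) : gaussianPDFReal 0 1 g • callPayoff s K r T v g
      = (Set.Ioi (-d2)).indicator
        (fun g ↦ F * gaussianPDFReal 0 1 (g - a) - K * gaussianPDFReal 0 1 g) g := by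
    have hlog : K < F * Real.exp (a * g - a ^ 2 / 2) ↔ -d2 < g := by
      rw [hF, ← Real.exp_add, ← Real.log_lt_iff_lt_exp hK, haa, neg_lt, hd2, lt_div_iff₀ ha0]
      constructor <;> intro h <;> linarith
    rw [callPayoff, hexp, smul_eq_mul]
    by_cases hg : -d2 < g
    · rw [Set.indicator_of_mem (Set.mem_Ioi.2 hg), max_eq_left (by linarith [hlog.2 hg]),
        ← gaussianPDFReal_mul_exp]
      ring
    · rw [Set.indicator_of_notMem (by simpa using hg),
        max_eq_right (by linarith [not_lt.1 (mt hlog.1 hg)]), mul_zero]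
  have hshift : ∫ g in Set.Ioi (-d2), gaussianPDFReal 0 1 (g - a) = Phi (d2 + a) := by
    have h := (measurePreserving_sub_right volume a).setIntegral_preimage_emb
      (measurableEmbedding_subRight a) (gaussianPDFReal 0 1) (Set.Ioi (-(d2 + a)))
    have hp : (fun x : ℝ ↦ x - a) ⁻¹' Set.Ioi (-(d2 + a)) = Set.Ioi (-d2) := by
      ext x
      simp only [Set.mem_preimage, Set.mem_Ioi]
      constructor <;> intro h <;> linarith
    rw [← setIntegral_Ioi_gaussianPDFReal, ← h, hp]
  rw [integral_gaussianReal_eq_integral_smul one_ne_zero]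
  simp_rw [hpay]
  rw [integral_indicator measurableSet_Ioi, integral_sub
    ((hi.comp_sub_right a).const_mul F).integrableOn (hi.const_mul K).integrableOn,
    integral_const_mul, integral_const_mul, hshift, setIntegral_Ioi_gaussianPDFReal]
  have hsq : √(1 / T * v) * √T = a := by
    rw [← Real.sqrt_mul (by positivity)]
    congr 1
    field_simp
  have hsq2 : √(1 / T * v) ^ 2 * T = v := by
    rw [Real.sq_sqrt (by positivity)]
    field_simp
  rw [blackScholes, hsq]
  congr 3
  · rw [hd2, div_add' _ _ _ ha0.ne']
    congr 1
    linear_combination haa - hsq2 / 2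
  · rw [hd2]
    congr 1
    linear_combination hsq2 / 2

lemma integrable_exp_gaussianReal (c a : ℝ) :
    Integrable (fun g ↦ Real.exp (c + a * g)) (gaussianReal 0 1) := by
  simp_rw [Real.exp_add]
  exact (integrable_exp_mul_gaussianReal a).const_mul _

lemma callPayoff_le {s : ℝ} {K : ℝ} (r T v g : ℝ) (hs : 0 < s) (hK : 0 < K) :
    callPayoff s K r T v g ≤ s * Real.exp (r * T - 1 / 2 * v + √v * g) :=
  max_le (by linarith) (by positivity)

lemma integrable_callPayoff {s K : ℝ} (r T v : ℝ) (hs : 0 < s) (hK : 0 < K) :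
    Integrable (callPayoff s K r T v) (gaussianReal 0 1) := by
  refine ((integrable_exp_gaussianReal (r * T - 1 / 2 * v) √v).const_mul s).mono'
    (((measurable_callPayoff s K r T).comp measurable_prodMk_left).aestronglyMeasurable)
    (.of_forall fun g ↦ ?_)
  rw [Real.norm_of_nonneg (callPayoff_nonneg ..)]
  exact callPayoff_le r T v g hs hK

/-! ### Riemann sums and the linear Volterra equation -/

lemma tendsto_leftRiemannSum {f : ℝ → ℝ} {t : ℝ} (ht : 0 ≤ t) (hf : ContinuousOn f (Set.Icc 0 t)) :
    Tendsto (fun n : ℕ ↦ t / n * ∑ i ∈ Finset.range n, f (i * t / n)) atTop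
      (𝓝 (∫ u in (0 : ℝ)..t, f u)) := by
  have huc := isCompact_Icc.uniformContinuousOn_of_continuous hf
  rw [Metric.uniformContinuousOn_iff_le] at huc
  rw [Metric.tendsto_atTop']
  intro ε hε
  obtain ⟨δ, hδ, h⟩ := huc (ε / (t + 1)) (by positivity)
  obtain ⟨N, hN⟩ := exists_nat_gt (t / δ)
  refine ⟨N, fun n hn ↦ ?_⟩
  have hn0 : (0 : ℝ) < n := by
    have : 0 < n := by omega
    exact_mod_cast this
  have hmesh : t / n ≤ δ := by
    rw [div_le_iff₀ hn0]
    rw [div_lt_iff₀ hδ] at hN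
    have : (N : ℝ) ≤ n := by exact_mod_cast hn.le
    nlinarith
  set a : ℕ → ℝ := fun i ↦ i * t / n with ha
  have hstep (i : ℕ) : a (i + 1) = a i + t / n := by
    simp only [ha]
    push_cast
    ring
  have hle (i : ℕ) : a i ≤ a (i + 1) := by
    rw [hstep]
    have : 0 ≤ t / n := by positivity
    linarith
  have hsub (i : ℕ) (hi : i < n) : Set.Icc (a i) (a (i + 1)) ⊆ Set.Icc 0 t := by
    refine Set.Icc_subset_Icc (by simp only [ha]; positivity) ?_
    simp only [ha]
    rw [div_le_iff₀ hn0, mul_comm]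
    have : ((i + 1 : ℕ) : ℝ) ≤ n := by exact_mod_cast hi
    gcongr
  have hint (i : ℕ) (hi : i < n) : IntervalIntegrable f volume (a i) (a (i + 1)) :=
    (hf.mono (by rw [Set.uIcc_of_le (hle i)]; exact hsub i hi)).intervalIntegrable
  have hsum : ∫ u in (0 : ℝ)..t, f u = ∑ i ∈ Finset.range n, ∫ u in a i..a (i + 1), f u := by
    rw [intervalIntegral.sum_integral_adjacent_intervals hint]
    simp only [ha]
    congr 1
    · simp
    · field_simp
  have hcell (i : ℕ) (hi : i < n) :
      |t / n * f (a i) - ∫ u in a i..a (i + 1), f u| ≤ ε / (t + 1) * (t / n) := by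
    have h1 : t / n * f (a i) = ∫ _ in a i..a (i + 1), f (a i) := by
      rw [intervalIntegral.integral_const, hstep, smul_eq_mul]
      ring
    have h2 := intervalIntegral.norm_integral_le_of_norm_le_const (a := a i) (b := a (i + 1))
      (C := ε / (t + 1)) (f := fun u ↦ f (a i) - f u) fun u hu ↦ by
        rw [Set.uIoc_of_le (hle i)] at hu
        refine h _ (hsub i hi ⟨le_rfl, hle i⟩) _ (hsub i hi ⟨hu.1.le, hu.2⟩) ?_
        rw [dist_comm, Real.dist_eq, abs_of_nonneg (by linarith [hu.1])]
        linarith [hu.2, hstep i]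
    rw [h1, ← intervalIntegral.integral_sub (by simp) (hint i hi)]
    refine h2.trans_eq ?_
    rw [hstep, add_sub_cancel_left, abs_of_nonneg (by positivity)]
  rw [Real.dist_eq, hsum, Finset.mul_sum, ← Finset.sum_sub_distrib]
  refine (Finset.abs_sum_le_sum_abs _ _).trans_lt ?_
  refine (Finset.sum_le_sum fun i hi ↦ hcell i (Finset.mem_range.1 hi)).trans_lt ?_
  rw [Finset.sum_const, Finset.card_range, nsmul_eq_mul]
  calc (n : ℝ) * (ε / (t + 1) * (t / n)) = ε * (t / (t + 1)) := by field_simp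
    _ < ε * 1 := by
      gcongr
      rw [div_lt_one (by positivity)]
      linarith
    _ = ε := mul_one ε

/-- Variation of constants for the linear Volterra equation `y = f - α ∫ y`. -/
lemma eq_of_eq_sub_mul_integral {y f : ℝ → ℝ} (hy : Continuous y) (hf : Continuous f)
    {α T : ℝ} (h : ∀ t ∈ Set.Icc 0 T, y t = f t - α * ∫ u in (0 : ℝ)..t, y u) {t : ℝ}
    (ht : t ∈ Set.Icc 0 T) :
    y t = f t - α * (Real.exp (-(α * t)) * ∫ u in (0 : ℝ)..t, Real.exp (α * u) * f u) := by
  have hJ (u : ℝ) : HasDerivAt (fun v ↦ ∫ w in (0 : ℝ)..v, y w) (y u) u :=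
    intervalIntegral.integral_hasDerivAt_right (hy.intervalIntegrable _ _)
      hy.stronglyMeasurable.stronglyMeasurableAtFilter hy.continuousAt
  have hE (u : ℝ) : HasDerivAt (fun v ↦ Real.exp (α * v)) (Real.exp (α * u) * α) u := by
    simpa using ((hasDerivAt_id u).const_mul α).exp
  have hderiv : ∀ u ∈ Set.uIcc 0 t, HasDerivAt
      (fun v ↦ Real.exp (α * v) * ∫ w in (0 : ℝ)..v, y w) (Real.exp (α * u) * f u) u := by
    intro u hu
    rw [Set.uIcc_of_le ht.1] at hu
    refine ((hE u).mul (hJ u)).congr_deriv ?_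
    rw [h u ⟨hu.1, hu.2.trans ht.2⟩]
    ring
  rw [intervalIntegral.integral_eq_sub_of_hasDerivAt hderiv
    (Continuous.intervalIntegrable (by fun_prop) _ _), h t ht]
  simp only [intervalIntegral.integral_same, mul_zero, sub_zero]
  rw [← mul_assoc (Real.exp _), ← Real.exp_add]
  simp

/-- A bound for the solution that requires no a priori estimate of it: since `α ≥ 0`, the kernel
`exp (-α (t - u))` of the variation of constants formula is at most one. -/
lemma abs_le_of_eq_sub_mul_integral {y f : ℝ → ℝ} (hy : Continuous y) (hf : Continuous f)
    {α T : ℝ} (hα : 0 ≤ α) (h : ∀ t ∈ Set.Icc 0 T, y t = f t - α * ∫ u in (0 : ℝ)..t, y u)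
    {t : ℝ} (ht : t ∈ Set.Icc 0 T) :
    |y t| ≤ |f t| + α * ∫ u in (0 : ℝ)..T, |f u| := by
  have h1 : |∫ u in (0 : ℝ)..t, Real.exp (α * u) * f u|
      ≤ Real.exp (α * t) * ∫ u in (0 : ℝ)..t, |f u| := by
    refine (intervalIntegral.abs_integral_le_integral_abs ht.1).trans ?_
    rw [← intervalIntegral.integral_const_mul]
    refine intervalIntegral.integral_mono_on ht.1 (Continuous.intervalIntegrable (by fun_prop) _ _)
      (Continuous.intervalIntegrable (by fun_prop) _ _) fun u hu ↦ ?_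
    rw [abs_mul, Real.abs_exp]
    gcongr
    exact hu.2
  have h2 : ∫ u in (0 : ℝ)..t, |f u| ≤ ∫ u in (0 : ℝ)..T, |f u| :=
    intervalIntegral.integral_mono_interval le_rfl ht.1 ht.2 (.of_forall fun _ ↦ abs_nonneg _)
      (Continuous.intervalIntegrable (by fun_prop) _ _)
  rw [eq_of_eq_sub_mul_integral hy hf h ht]
  refine (abs_sub _ _).trans ?_
  gcongr
  rw [abs_mul, abs_mul, Real.abs_exp, abs_of_nonneg hα]
  gcongr
  calc _ ≤ Real.exp (-(α * t)) * (Real.exp (α * t) * ∫ u in (0 : ℝ)..t, |f u|) := by gcongr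
    _ = ∫ u in (0 : ℝ)..t, |f u| := by rw [← mul_assoc, ← Real.exp_add]; simp
    _ ≤ _ := h2

/-! ### Joint measurability and first moments -/

section

variable {Ω : Type*} [MeasurableSpace Ω] {Q : Measure Ω}

/-- A process with almost surely continuous paths on `[0, T]` is indistinguishable there from a
jointly measurable process, indexed by `ℝ`, all of whose paths are continuous. -/
lemma exists_continuous_version {X : ℝ≥0 → Ω → ℝ} {T : ℝ≥0} (hX : ∀ t, Measurable (X t))
    (hc : ∀ᵐ ω ∂Q, ContinuousOn (fun t ↦ X t ω) (Set.Iic T)) :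
    ∃ X' : ℝ → Ω → ℝ, Measurable (Function.uncurry X') ∧ (∀ ω, Continuous fun t ↦ X' t ω) ∧
      ∀ᵐ ω ∂Q, ∀ t : ℝ≥0, t ≤ T → X' t ω = X t ω := by
  obtain ⟨s, hs, hsm, hcs⟩ := hc.exists_measurable_mem
  have hcont : ∀ ω, Continuous fun t : ℝ ↦ s.indicator (X (min t.toNNReal T)) ω := by
    intro ω
    by_cases hω : ω ∈ s
    · simp only [Set.indicator_of_mem hω]
      exact (hcs ω hω).comp_continuous (by fun_prop) fun t ↦ Set.mem_Iic.2 (min_le_right _ _)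
    · simp only [Set.indicator_of_notMem hω]
      exact continuous_const
  refine ⟨fun t ω ↦ s.indicator (X (min t.toNNReal T)) ω, ?_, hcont, ?_⟩
  · exact measurable_uncurry_of_continuous_of_measurable hcont fun t ↦ (hX _).indicator hsm
  · filter_upwards [hs] with ω hω t ht
    rw [Set.indicator_of_mem hω, Real.toNNReal_coe, min_eq_left ht]

lemma integrable_and_integral_intervalIntegral_abs_le [SFinite Q] {X : ℝ → Ω → ℝ}
    (hX : Measurable (Function.uncurry X)) {a b C : ℝ} (hab : a ≤ b)
    (hi : ∀ u ∈ Set.Icc a b, Integrable (X u) Q)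
    (hC : ∀ u ∈ Set.Icc a b, ∫ ω, |X u ω| ∂Q ≤ C) :
    Integrable (fun ω ↦ ∫ u in a..b, |X u ω|) Q ∧
      ∫ ω, (∫ u in a..b, |X u ω|) ∂Q ≤ C * (b - a) := by
  have hm : StronglyMeasurable (Function.uncurry fun u ω ↦ |X u ω|) :=
    (hX.norm).stronglyMeasurable
  have hnorm : Integrable (fun u ↦ ∫ ω, |X u ω| ∂Q) (volume.restrict (Set.Ioc a b)) := by
    refine Integrable.mono' (g := fun _ ↦ C) (integrable_const C)
      hm.integral_prod_right.aestronglyMeasurable ?_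
    refine (ae_restrict_mem measurableSet_Ioc).mono fun u hu ↦ ?_
    rw [Real.norm_of_nonneg (integral_nonneg fun _ ↦ abs_nonneg _)]
    exact hC u ⟨hu.1.le, hu.2⟩
  have hprod : Integrable (Function.uncurry fun u ω ↦ |X u ω|)
      ((volume.restrict (Set.Ioc a b)).prod Q) := by
    rw [integrable_prod_iff hm.aestronglyMeasurable]
    refine ⟨(ae_restrict_mem measurableSet_Ioc).mono fun u hu ↦
      (hi u ⟨hu.1.le, hu.2⟩).abs, ?_⟩
    simpa [Function.uncurry] using hnorm
  simp_rw [intervalIntegral.integral_of_le hab]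
  refine ⟨hprod.integral_prod_right, ?_⟩
  rw [← integral_integral_swap hprod]
  calc _ ≤ ∫ _ in Set.Ioc a b, C :=
        integral_mono_ae hnorm (integrable_const C)
          ((ae_restrict_mem measurableSet_Ioc).mono fun u hu ↦ hC u ⟨hu.1.le, hu.2⟩)
    _ = C * (b - a) := by
      rw [setIntegral_const, measureReal_def, Real.volume_Ioc, ENNReal.toReal_ofReal (by linarith),
        smul_eq_mul, mul_comm]

lemma integral_abs_le_sqrt_of_hasLaw_gaussianReal {X : Ω → ℝ} {v : ℝ≥0}
    (h : HasLaw X (gaussianReal 0 v) Q) : ∫ ω, |X ω| ∂Q ≤ √v := by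
  have : IsProbabilityMeasure Q := h.isProbabilityMeasure
  have hL := h.hasGaussianLaw.memLp_two
  have hsq : ∫ ω, X ω ^ 2 ∂Q = v := by
    have h0 : ∫ ω, X ω ∂Q = 0 := by rw [h.integral_eq, integral_id_gaussianReal]
    have := h.variance_eq
    rw [variance_of_integral_eq_zero h.aemeasurable h0, variance_id_gaussianReal] at this
    exact this
  have h1 : (∫ ω, |X ω| ∂Q) ^ 2 ≤ v := by
    have := variance_nonneg |X| Q
    rw [variance_eq_sub hL.abs] at this
    simp only [Pi.pow_apply, Pi.abs_apply, sq_abs, hsq] at this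
    linarith
  exact Real.le_sqrt_of_sq_le h1

end

/-! ### Moments of the Ornstein-Uhlenbeck process and error of the Euler-Maruyama scheme -/

section

variable {Ω : Type*} [MeasurableSpace Ω] {Q : Measure Ω}

/-- Versions of the Ornstein-Uhlenbeck process and of its driving Wiener process that are jointly
measurable with continuous paths, and satisfy the integral equation on `[0, T]`. -/
lemma IsOrnsteinUhlenbeck.exists_continuous_versions {α k y₀ : ℝ} {T : ℝ≥0}
    {Z Y : ℝ≥0 → Ω → ℝ} (hY : IsOrnsteinUhlenbeck Q α k y₀ T Z Y) (hZ : IsBrownianReal Z Q)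
    (hZm : ∀ t, Measurable (Z t)) :
    ∃ Y' Z' : ℝ → Ω → ℝ, Measurable (Function.uncurry Y') ∧ Measurable (Function.uncurry Z') ∧
      (∀ ω, Continuous fun t ↦ Y' t ω) ∧ (∀ ω, Continuous fun t ↦ Z' t ω) ∧
      (∀ᵐ ω ∂Q, ∀ t : ℝ≥0, t ≤ T → Y' t ω = Y t ω) ∧
      (∀ᵐ ω ∂Q, ∀ t : ℝ≥0, t ≤ T → Z' t ω = Z t ω) ∧
      ∀ᵐ ω ∂Q, ∀ t ∈ Set.Icc (0 : ℝ) T,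
        Y' t ω = (y₀ + k * Z' t ω) - α * ∫ u in (0 : ℝ)..t, Y' u ω := by
  obtain ⟨Y', hY'm, hY'c, hY'e⟩ := exists_continuous_version hY.measurable hY.continuousOn
  obtain ⟨Z', hZ'm, hZ'c, hZ'e⟩ := exists_continuous_version (T := T) hZm
    (hZ.cont.mono fun ω h ↦ h.continuousOn)
  refine ⟨Y', Z', hY'm, hZ'm, hY'c, hZ'c, hY'e, hZ'e, ?_⟩
  filter_upwards [hY'e, hZ'e, hY.sde] with ω h1 h2 h3 t ht
  lift t to ℝ≥0 using ht.1
  have htT : t ≤ T := by exact_mod_cast ht.2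
  have hint : ∫ u in (0 : ℝ)..t, Y u.toNNReal ω = ∫ u in (0 : ℝ)..t, Y' u ω := by
    refine intervalIntegral.integral_congr fun u hu ↦ ?_
    rw [Set.uIcc_of_le t.coe_nonneg] at hu
    have := h1 u.toNNReal (by rw [Real.toNNReal_le_iff_le_coe]; exact hu.2.trans ht.2)
    rw [Real.coe_toNNReal _ hu.1] at this
    exact this.symm
  rw [h1 t htT, h2 t htT, h3 t htT, hint]
  ring

lemma integral_abs_sub_le_of_isPreBrownianReal {Z : ℝ≥0 → Ω → ℝ} (hZ : IsPreBrownianReal Z Q)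
    {u v : ℝ≥0} (h : v ≤ u) : ∫ ω, |Z u ω - Z v ω| ∂Q ≤ √((u : ℝ) - v) := by
  have h1 := integral_abs_le_sqrt_of_hasLaw_gaussianReal (hZ.hasLaw_sub u v)
  have h2 : ((nndist (u : ℝ) v : ℝ≥0) : ℝ) = (u : ℝ) - v := by
    rw [coe_nndist, Real.dist_eq, abs_of_nonneg (sub_nonneg.2 (by exact_mod_cast h))]
  rw [← h2]
  exact h1

/-- A bound for the first absolute moments of the Ornstein-Uhlenbeck process on `[0, T]`. -/
noncomputable def momentBound (α k y₀ : ℝ) (T : ℝ≥0) : ℝ :=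
  (|y₀| + k * √T) + α * ((|y₀| + k * √T) * T)

/-- The constant in the bound of `E|Yᵤ - Yᵥ|` by a multiple of `√(u - v)`. -/
noncomputable def incrementBound (α k y₀ : ℝ) (T : ℝ≥0) : ℝ :=
  α * momentBound α k y₀ T * √T + k

section

variable {α k y₀ : ℝ} {T : ℝ≥0} {Z Y : ℝ≥0 → Ω → ℝ}

lemma momentBound_nonneg (hα : 0 ≤ α) (hk : 0 ≤ k) : 0 ≤ momentBound α k y₀ T := by
  unfold momentBound
  positivity

lemma incrementBound_nonneg (hα : 0 ≤ α) (hk : 0 ≤ k) : 0 ≤ incrementBound α k y₀ T := by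
  have := momentBound_nonneg (y₀ := y₀) (T := T) hα hk
  unfold incrementBound
  positivity

lemma IsOrnsteinUhlenbeck.integrable_and_integral_abs_le [IsProbabilityMeasure Q]
    (hY : IsOrnsteinUhlenbeck Q α k y₀ T Z Y) (hZ : IsBrownianReal Z Q)
    (hZm : ∀ t, Measurable (Z t)) (hα : 0 ≤ α) (hk : 0 ≤ k) {t : ℝ≥0} (ht : t ≤ T) :
    Integrable (Y t) Q ∧ ∫ ω, |Y t ω| ∂Q ≤ momentBound α k y₀ T := by
  obtain ⟨Y', Z', -, hZ'm, hY'c, hZ'c, hY'e, hZ'e, hsde⟩ :=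
    hY.exists_continuous_versions hZ hZm
  have hf : ∀ u : ℝ≥0, u ≤ T → Integrable (fun ω ↦ y₀ + k * Z' u ω) Q ∧
      ∫ ω, |y₀ + k * Z' u ω| ∂Q ≤ |y₀| + k * √T := by
    intro u hu
    have hae : ∀ᵐ ω ∂Q, Z' u ω = Z u ω := hZ'e.mono fun ω h ↦ h u hu
    have hZi : Integrable (Z' u) Q := (hZ.integrable_eval u).congr (hae.mono fun _ h ↦ h.symm)
    have hZb : ∫ ω, |Z' u ω| ∂Q ≤ √T := by
      rw [integral_congr_ae (hae.mono fun ω h ↦ by rw [h])]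
      exact (integral_abs_le_sqrt_of_hasLaw_gaussianReal (hZ.hasLaw_eval u)).trans
        (Real.sqrt_le_sqrt (by exact_mod_cast hu))
    refine ⟨(integrable_const y₀).add (hZi.const_mul k), ?_⟩
    calc ∫ ω, |y₀ + k * Z' u ω| ∂Q ≤ ∫ ω, (|y₀| + k * |Z' u ω|) ∂Q := by
          refine integral_mono ((integrable_const y₀).add (hZi.const_mul k)).abs
            ((integrable_const |y₀|).add (hZi.abs.const_mul k)) fun ω ↦ ?_
          refine (abs_add_le _ _).trans ?_
          rw [abs_mul, abs_of_nonneg hk]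
      _ = |y₀| + k * ∫ ω, |Z' u ω| ∂Q := by
          rw [integral_add (integrable_const _) (hZi.abs.const_mul k), integral_const_mul]
          simp
      _ ≤ _ := by gcongr
  have hf' : ∀ u ∈ Set.Icc (0 : ℝ) T, Integrable (fun ω ↦ y₀ + k * Z' u ω) Q ∧
      ∫ ω, |y₀ + k * Z' u ω| ∂Q ≤ |y₀| + k * √T := by
    intro u hu
    lift u to ℝ≥0 using hu.1
    exact hf u (by exact_mod_cast hu.2)
  obtain ⟨hJi, hJb⟩ := integrable_and_integral_intervalIntegral_abs_le (Q := Q)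
    (X := fun u ω ↦ y₀ + k * Z' u ω) ((hZ'm.const_mul k).const_add y₀) T.2
    (fun u hu ↦ (hf' u hu).1) fun u hu ↦ (hf' u hu).2
  have hbound : ∀ᵐ ω ∂Q, |Y t ω| ≤
      |y₀ + k * Z' t ω| + α * ∫ u in (0 : ℝ)..T, |y₀ + k * Z' u ω| := by
    filter_upwards [hY'e, hsde] with ω h1 h2
    rw [← h1 t ht]
    have := hZ'c ω
    exact abs_le_of_eq_sub_mul_integral (f := fun u ↦ y₀ + k * Z' u ω) (hY'c ω) (by fun_prop) hα h2
      ⟨t.2, by exact_mod_cast ht⟩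
  have hdom := (hf t ht).1.abs.add (hJi.const_mul α)
  have hYi : Integrable (Y t) Q := hdom.mono' (hY.measurable t).aestronglyMeasurable hbound
  refine ⟨hYi, (integral_mono_ae hYi.abs hdom hbound).trans ?_⟩
  simp only [Pi.add_apply]
  rw [integral_add (hf t ht).1.abs (hJi.const_mul α), integral_const_mul, momentBound]
  have := (hf t ht).2
  rw [sub_zero] at hJb
  gcongr
  exact hJb

lemma IsOrnsteinUhlenbeck.integral_abs_sub_le [IsProbabilityMeasure Q]
    (hY : IsOrnsteinUhlenbeck Q α k y₀ T Z Y) (hZ : IsBrownianReal Z Q)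
    (hZm : ∀ t, Measurable (Z t)) (hα : 0 ≤ α) (hk : 0 ≤ k) {u v : ℝ≥0} (hvu : v ≤ u)
    (hu : u ≤ T) :
    ∫ ω, |Y u ω - Y v ω| ∂Q ≤ incrementBound α k y₀ T * √((u : ℝ) - v) := by
  obtain ⟨Y', Z', hY'm, -, hY'c, -, hY'e, hZ'e, hsde⟩ := hY.exists_continuous_versions hZ hZm
  have hvu' : (v : ℝ) ≤ u := by exact_mod_cast hvu
  have huT : (u : ℝ) ≤ T := by exact_mod_cast hu
  have hM : ∀ w ∈ Set.Icc (v : ℝ) u, Integrable (Y' w) Q ∧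
      ∫ ω, |Y' w ω| ∂Q ≤ momentBound α k y₀ T := by
    intro w hw
    lift w to ℝ≥0 using v.2.trans hw.1
    have hwT : w ≤ T := by exact_mod_cast hw.2.trans huT
    have hae : ∀ᵐ ω ∂Q, Y' w ω = Y w ω := hY'e.mono fun ω h ↦ h w hwT
    obtain ⟨h1, h2⟩ := hY.integrable_and_integral_abs_le hZ hZm hα hk hwT
    refine ⟨h1.congr (hae.mono fun _ h ↦ h.symm), ?_⟩
    rwa [integral_congr_ae (hae.mono fun ω h ↦ by rw [h])]
  obtain ⟨hJi, hJb⟩ := integrable_and_integral_intervalIntegral_abs_le hY'm hvu'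
    (fun w hw ↦ (hM w hw).1) fun w hw ↦ (hM w hw).2
  have hZi : Integrable (fun ω ↦ |Z u ω - Z v ω|) Q :=
    ((hZ.integrable_eval u).sub (hZ.integrable_eval v)).abs
  have hbound : ∀ᵐ ω ∂Q, |Y u ω - Y v ω| ≤
      α * (∫ w in (v : ℝ)..u, |Y' w ω|) + k * |Z u ω - Z v ω| := by
    filter_upwards [hY'e, hZ'e, hsde] with ω h1 h2 h3
    have hc := hY'c ω
    have h4 := intervalIntegral.integral_interval_sub_left
      (hc.intervalIntegrable (μ := volume) 0 u) (hc.intervalIntegrable (μ := volume) 0 v)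
    rw [← h1 u hu, ← h1 v (hvu.trans hu), ← h2 u hu, ← h2 v (hvu.trans hu),
      h3 u ⟨u.2, huT⟩, h3 v ⟨v.2, hvu'.trans huT⟩]
    have h5 : y₀ + k * Z' u ω - α * (∫ w in (0 : ℝ)..u, Y' w ω)
        - (y₀ + k * Z' v ω - α * ∫ w in (0 : ℝ)..v, Y' w ω)
        = k * (Z' u ω - Z' v ω) - α * ∫ w in (v : ℝ)..u, Y' w ω := by
      linear_combination -α * h4
    rw [h5, add_comm]
    refine (abs_sub _ _).trans ?_
    rw [abs_mul, abs_mul, abs_of_nonneg hk, abs_of_nonneg hα]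
    gcongr
    exact intervalIntegral.abs_integral_le_integral_abs hvu'
  have hYi (w : ℝ≥0) (hw : w ≤ T) := (hY.integrable_and_integral_abs_le hZ hZm hα hk hw).1
  refine (integral_mono_ae ((hYi u hu).sub (hYi v (hvu.trans hu))).abs
    ((hJi.const_mul α).add (hZi.const_mul k)) hbound).trans ?_
  simp only [Pi.add_apply]
  rw [integral_add (hJi.const_mul α) (hZi.const_mul k), integral_const_mul, integral_const_mul]
  have hZb := integral_abs_sub_le_of_isPreBrownianReal hZ.toIsPreBrownianReal hvu
  have hM0 := momentBound_nonneg (y₀ := y₀) (T := T) hα hk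
  have hsq : (u : ℝ) - v ≤ √T * √((u : ℝ) - v) := by
    calc (u : ℝ) - v = √((u : ℝ) - v) * √((u : ℝ) - v) :=
          (Real.mul_self_sqrt (sub_nonneg.2 hvu')).symm
      _ ≤ _ := by
        gcongr
        linarith [v.2]
  calc _ ≤ α * (momentBound α k y₀ T * (√T * √((u : ℝ) - v))) + k * √((u : ℝ) - v) := by
        gcongr
        exact hJb.trans (by gcongr)
    _ = _ := by rw [incrementBound]; ring

end

lemma measurable_eulerOU {Z : ℝ≥0 → Ω → ℝ} (hZm : ∀ t, Measurable (Z t)) (α k y₀ : ℝ) (T : ℝ≥0)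
    (m l : ℕ) : Measurable (eulerOU α k y₀ T Z m l) := by
  induction l with
  | zero => exact measurable_const
  | succ l ih =>
    have h1 := hZm (((l : ℝ≥0) + 1) * T / m)
    have h2 := hZm ((l : ℝ≥0) * T / m)
    simp only [funext fun ω ↦ eulerOU.eq_2 α k y₀ T Z m ω l]
    fun_prop

lemma integrable_eulerOU [IsFiniteMeasure Q] {Z : ℝ≥0 → Ω → ℝ} (hZ : ∀ t, Integrable (Z t) Q)
    (α k y₀ : ℝ) (T : ℝ≥0) (m l : ℕ) : Integrable (eulerOU α k y₀ T Z m l) Q := by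
  induction l with
  | zero => exact integrable_const _
  | succ l ih =>
    simp only [funext fun ω ↦ eulerOU.eq_2 α k y₀ T Z m ω l]
    exact (ih.const_mul _).add (((hZ _).sub (hZ _)).const_mul k)

section

variable {α k y₀ : ℝ} {T : ℝ≥0} {Z Y : ℝ≥0 → Ω → ℝ}

/-- The one-step recursion for the mean error of the Euler-Maruyama scheme. -/
lemma IsOrnsteinUhlenbeck.integral_abs_sub_eulerOU_succ_le [IsProbabilityMeasure Q]
    (hY : IsOrnsteinUhlenbeck Q α k y₀ T Z Y) (hZ : IsBrownianReal Z Q)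
    (hZm : ∀ t, Measurable (Z t)) (hα : 0 ≤ α) (hk : 0 ≤ k) {m l : ℕ} (hl : l < m) :
    ∫ ω, |Y (((l : ℝ≥0) + 1) * T / m) ω - eulerOU α k y₀ T Z m (l + 1) ω| ∂Q ≤
      (1 + α * (T / m)) * (∫ ω, |Y ((l : ℝ≥0) * T / m) ω - eulerOU α k y₀ T Z m l ω| ∂Q) +
        α * (incrementBound α k y₀ T * √(T / m) * (T / m)) := by
  obtain ⟨Y', Z', hY'm, -, hY'c, -, hY'e, hZ'e, hsde⟩ := hY.exists_continuous_versions hZ hZm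
  have hm : 0 < m := by omega
  have hm' : (0 : ℝ) < m := by exact_mod_cast hm
  set v : ℝ≥0 := (l : ℝ≥0) * T / m with hv
  set u : ℝ≥0 := ((l : ℝ≥0) + 1) * T / m with hu
  set h : ℝ := (T : ℝ) / m with hh
  have huv : (u : ℝ) - v = h := by
    rw [hu, hv, hh]
    push_cast
    ring
  have hh0 : 0 ≤ h := by rw [hh]; positivity
  have hvu : v ≤ u := by
    rw [← NNReal.coe_le_coe]
    linarith
  have huT : u ≤ T := by
    rw [hu, div_le_iff₀ (by exact_mod_cast hm), mul_comm]
    gcongr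
    exact_mod_cast hl
  have hvu' : (v : ℝ) ≤ u := by exact_mod_cast hvu
  have huT' : (u : ℝ) ≤ T := by exact_mod_cast huT
  have hYi (w : ℝ≥0) (hw : w ≤ T) := (hY.integrable_and_integral_abs_le hZ hZm hα hk hw).1
  have hD : ∀ w ∈ Set.Icc (v : ℝ) u, Integrable (fun ω ↦ Y' w ω - Y' v ω) Q ∧
      ∫ ω, |Y' w ω - Y' v ω| ∂Q ≤ incrementBound α k y₀ T * √h := by
    intro w hw
    lift w to ℝ≥0 using v.2.trans hw.1
    have hwT : w ≤ T := by exact_mod_cast hw.2.trans huT'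
    have hae : ∀ᵐ ω ∂Q, Y' w ω - Y' v ω = Y w ω - Y v ω :=
      hY'e.mono fun ω h ↦ by rw [h w hwT, h v (hvu.trans huT)]
    refine ⟨((hYi w hwT).sub (hYi v (hvu.trans huT))).congr (hae.mono fun _ h ↦ h.symm), ?_⟩
    rw [integral_congr_ae (hae.mono fun ω h ↦ by rw [h])]
    refine (hY.integral_abs_sub_le hZ hZm hα hk (by exact_mod_cast hw.1) hwT).trans ?_
    have := incrementBound_nonneg (y₀ := y₀) (T := T) hα hk
    gcongr
    linarith [hw.2]
  have hmeas : Measurable (Function.uncurry fun (w : ℝ) ω ↦ Y' w ω - Y' v ω) :=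
    hY'm.sub (hY'm.comp (measurable_const.prodMk measurable_snd))
  obtain ⟨hJi, hJb⟩ := integrable_and_integral_intervalIntegral_abs_le hmeas hvu'
    (fun w hw ↦ (hD w hw).1) fun w hw ↦ (hD w hw).2
  have hbound : ∀ᵐ ω ∂Q, |Y u ω - eulerOU α k y₀ T Z m (l + 1) ω| ≤
      (1 + α * h) * |Y v ω - eulerOU α k y₀ T Z m l ω|
        + α * ∫ w in (v : ℝ)..u, |Y' w ω - Y' v ω| := by
    filter_upwards [hY'e, hZ'e, hsde] with ω h1 h2 h3
    have hc := hY'c ω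
    have h4 := intervalIntegral.integral_interval_sub_left
      (hc.intervalIntegrable (μ := volume) 0 u) (hc.intervalIntegrable (μ := volume) 0 v)
    -- over one step, the scheme freezes the drift at the value of `Y` at the left endpoint
    have h6 : ∫ w in (v : ℝ)..u, (Y' w ω - Y' v ω)
        = (∫ w in (v : ℝ)..u, Y' w ω) - h * Y' v ω := by
      rw [intervalIntegral.integral_sub (hc.intervalIntegrable _ _) (by simp),
        intervalIntegral.integral_const, huv, smul_eq_mul]
    have e1 := h3 u ⟨u.2, huT'⟩
    have e2 := h3 v ⟨v.2, hvu'.trans huT'⟩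
    rw [eulerOU, ← hv, ← hu, ← h1 u huT, ← h1 v (hvu.trans huT), ← h2 u huT,
      ← h2 v (hvu.trans huT), ← hh]
    have h5 : Y' u ω - ((1 - α * h) * eulerOU α k y₀ T Z m l ω + k * (Z' u ω - Z' v ω))
        = (1 - α * h) * (Y' v ω - eulerOU α k y₀ T Z m l ω)
          - α * ∫ w in (v : ℝ)..u, (Y' w ω - Y' v ω) := by
      rw [h6]
      linear_combination e1 - e2 - α * h4
    rw [h5]
    refine (abs_sub _ _).trans ?_
    rw [abs_mul, abs_mul, abs_of_nonneg hα]
    have h7 : |1 - α * h| ≤ 1 + α * h := by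
      have : 0 ≤ α * h := by positivity
      rw [abs_le]
      constructor <;> linarith
    gcongr
    exact intervalIntegral.abs_integral_le_integral_abs hvu'
  have hEi (l : ℕ) := integrable_eulerOU hZ.integrable_eval α k y₀ T m l
  have hei := ((hYi v (hvu.trans huT)).sub (hEi l)).abs
  refine (integral_mono_ae ((hYi u huT).sub (hEi (l + 1))).abs
    ((hei.const_mul (1 + α * h)).add (hJi.const_mul α)) hbound).trans ?_
  simp only [Pi.add_apply]
  rw [integral_add (hei.const_mul (1 + α * h)) (hJi.const_mul α), integral_const_mul,
    integral_const_mul]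
  rw [huv] at hJb
  gcongr
  exact le_rfl

/-- The strong error of order one half of the Euler-Maruyama scheme at the grid points. -/
lemma IsOrnsteinUhlenbeck.integral_abs_sub_eulerOU_le [IsProbabilityMeasure Q]
    (hY : IsOrnsteinUhlenbeck Q α k y₀ T Z Y) (hZ : IsBrownianReal Z Q)
    (hZm : ∀ t, Measurable (Z t)) (hα : 0 ≤ α) (hk : 0 ≤ k) {m l : ℕ} (hm : 0 < m)
    (hl : l ≤ m) :
    ∫ ω, |Y ((l : ℝ≥0) * T / m) ω - eulerOU α k y₀ T Z m l ω| ∂Q ≤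
      α * incrementBound α k y₀ T * T * Real.exp (α * T) * √(T / m) := by
  have hC := incrementBound_nonneg (y₀ := y₀) (T := T) hα hk
  have hm' : (0 : ℝ) < m := by exact_mod_cast hm
  set c := α * (incrementBound α k y₀ T * √(T / m) * (T / m)) with hc
  have hc0 : 0 ≤ c := by positivity
  have hind : ∀ l ≤ m, ∫ ω, |Y ((l : ℝ≥0) * T / m) ω - eulerOU α k y₀ T Z m l ω| ∂Q ≤
      l * c * (1 + α * (T / m)) ^ l := by
    intro l
    induction l with
    | zero =>
      intro _
      have h0 : ∀ᵐ ω ∂Q, |Y (((0 : ℕ) : ℝ≥0) * T / m) ω - eulerOU α k y₀ T Z m 0 ω| = 0 := by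
        filter_upwards [hY.sde, hZ.eval_zero_ae_eq_zero] with ω h1 h2
        have := h1 0 zero_le
        simp only [Nat.cast_zero, zero_mul, zero_div, eulerOU, this, h2]
        simp
      rw [integral_congr_ae h0]
      simp
    | succ l ih =>
      intro hl
      have h1 := hY.integral_abs_sub_eulerOU_succ_le hZ hZm hα hk (m := m) (l := l) (by omega)
      have h2 := ih (by omega)
      have h3 : 1 ≤ (1 + α * ((T : ℝ) / m)) ^ (l + 1) :=
        one_le_pow₀ (by
          have : 0 ≤ α * ((T : ℝ) / m) := by positivity
          linarith)
      push_cast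
      refine h1.trans ?_
      calc _ ≤ (1 + α * ((T : ℝ) / m)) * (l * c * (1 + α * (T / m)) ^ l) + c * 1 := by
            rw [mul_one]
            gcongr
        _ ≤ (1 + α * ((T : ℝ) / m)) * (l * c * (1 + α * (T / m)) ^ l)
            + c * (1 + α * ((T : ℝ) / m)) ^ (l + 1) := by gcongr
        _ = _ := by ring
  refine (hind l hl).trans ?_
  have hexp : (1 + α * ((T : ℝ) / m)) ^ l ≤ Real.exp (α * T) := by
    calc (1 + α * ((T : ℝ) / m)) ^ l ≤ Real.exp (α * ((T : ℝ) / m)) ^ l := by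
          gcongr
          linarith [Real.add_one_le_exp (α * ((T : ℝ) / m))]
      _ = Real.exp (l * (α * ((T : ℝ) / m))) := (Real.exp_nat_mul _ _).symm
      _ ≤ Real.exp (m * (α * ((T : ℝ) / m))) := by gcongr
      _ = Real.exp (α * T) := by
        congr 1
        field_simp
  calc _ ≤ m * c * Real.exp (α * T) := by gcongr
    _ = _ := by
      rw [hc]
      field_simp

/-- The constant in the mean distance of order one half between the Ornstein-Uhlenbeck process and
its Euler-Maruyama scheme. -/
noncomputable def strongErrorBound (α k y₀ : ℝ) (T : ℝ≥0) : ℝ :=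
  incrementBound α k y₀ T + α * incrementBound α k y₀ T * T * Real.exp (α * T)

lemma strongErrorBound_nonneg (hα : 0 ≤ α) (hk : 0 ≤ k) : 0 ≤ strongErrorBound α k y₀ T := by
  have := incrementBound_nonneg (y₀ := y₀) (T := T) hα hk
  unfold strongErrorBound
  positivity

/-- Within a cell the process is compared with the value of the scheme at the right endpoint, which
is the one that enters the averaged volatility. -/
lemma IsOrnsteinUhlenbeck.integral_abs_sub_eulerOU_right_le [IsProbabilityMeasure Q]
    (hY : IsOrnsteinUhlenbeck Q α k y₀ T Z Y) (hZ : IsBrownianReal Z Q)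
    (hZm : ∀ t, Measurable (Z t)) (hα : 0 ≤ α) (hk : 0 ≤ k) {m l : ℕ} (hl : l < m) {u : ℝ≥0}
    (h1 : (l : ℝ≥0) * T / m ≤ u) (h2 : u ≤ ((l : ℝ≥0) + 1) * T / m) :
    ∫ ω, |Y u ω - eulerOU α k y₀ T Z m (l + 1) ω| ∂Q ≤
      strongErrorBound α k y₀ T * √(T / m) := by
  have hm : 0 < m := by omega
  have hvT : ((l : ℝ≥0) + 1) * T / m ≤ T := by
    rw [div_le_iff₀ (by exact_mod_cast hm), mul_comm]
    gcongr
    exact_mod_cast hl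
  have hC := incrementBound_nonneg (y₀ := y₀) (T := T) hα hk
  have hYi (w : ℝ≥0) (hw : w ≤ T) := (hY.integrable_and_integral_abs_le hZ hZm hα hk hw).1
  have hEi := integrable_eulerOU hZ.integrable_eval α k y₀ T m (l + 1)
  have e1 := hY.integral_abs_sub_le hZ hZm hα hk h2 hvT
  have e2 := hY.integral_abs_sub_eulerOU_le hZ hZm hα hk hm (l := l + 1) hl
  rw [Nat.cast_add, Nat.cast_one] at e2
  have e3 : √(((((l : ℝ≥0) + 1) * T / m : ℝ≥0) : ℝ) - u) ≤ √(T / m) := by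
    refine Real.sqrt_le_sqrt ?_
    rw [← NNReal.coe_le_coe] at h1
    push_cast at h1 ⊢
    have : ((l : ℝ) + 1) * T / m = l * T / m + T / m := by ring
    linarith
  refine (integral_mono (μ := Q) ((hYi u (h2.trans hvT)).sub hEi).abs
    (((hYi _ hvT).sub (hYi u (h2.trans hvT))).abs.add ((hYi _ hvT).sub hEi).abs)
    fun ω ↦ ?_).trans ?_
  · simp only [Pi.sub_apply, Pi.add_apply]
    rw [abs_sub_comm (Y _ ω) (Y u ω)]
    exact abs_sub_le _ _ _
  · rw [integral_add' ((hYi _ hvT).sub (hYi u (h2.trans hvT))).abs ((hYi _ hvT).sub hEi).abs]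
    refine (add_le_add (e1.trans (mul_le_mul_of_nonneg_left e3 hC)) e2).trans_eq ?_
    rw [strongErrorBound]
    ring

end

end

/-! ### Conditioning on the volatility path -/

section

variable {Ω E F : Type*} [MeasurableSpace Ω] [MeasurableSpace E] [MeasurableSpace F]
  {Q : Measure Ω}

/-- An almost sure limit of measurable functions of `X` is almost surely a measurable function of
`X`; the superior limit provides one. -/
lemma exists_measurable_comp_eq_of_tendsto {X : Ω → E} {f : ℕ → E → ℝ} {g : Ω → ℝ}
    (hf : ∀ n, Measurable (f n))
    (h : ∀ᵐ ω ∂Q, Tendsto (fun n ↦ f n (X ω)) atTop (𝓝 (g ω))) :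
    ∃ f' : E → ℝ, Measurable f' ∧ ∀ᵐ ω ∂Q, f' (X ω) = g ω :=
  ⟨fun x ↦ limsup (fun n ↦ f n x) atTop, Measurable.limsup hf,
    h.mono fun _ hω ↦ hω.limsup_eq⟩

/-- The Ornstein-Uhlenbeck process is a functional of its driving Wiener process, hence independent
of everything that the latter is independent of. -/
lemma IsOrnsteinUhlenbeck.indepFun {α k y₀ : ℝ} {T : ℝ≥0} {B Z Y : ℝ≥0 → Ω → ℝ}
    (hY : IsOrnsteinUhlenbeck Q α k y₀ T Z Y) (hZ : IsBrownianReal Z Q)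
    (hZm : ∀ t, Measurable (Z t))
    (hind : IndepFun (fun ω t ↦ B t ω) (fun ω t ↦ Z t ω) Q) :
    IndepFun (fun ω (t : Set.Iic T) ↦ Y t ω) (fun ω t ↦ B t ω) Q := by
  obtain ⟨Y', Z', -, -, hY'c, hZ'c, hY'e, hZ'e, hsde⟩ := hY.exists_continuous_versions hZ hZm
  have hlim (t : Set.Iic T) : ∃ g : (ℝ≥0 → ℝ) → ℝ, Measurable g ∧
      ∀ᵐ ω ∂Q, g (fun u ↦ Z u ω) = Y t ω := by
    obtain ⟨t, ht : t ≤ T⟩ := t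
    -- the value given by variation of constants, with the integral replaced by Riemann sums
    refine exists_measurable_comp_eq_of_tendsto
      (f := fun n z ↦ y₀ + k * z t - α * (Real.exp (-(α * t)) * (t / n * ∑ i ∈ Finset.range n,
        Real.exp (α * (i * t / n)) * (y₀ + k * z ((i : ℝ≥0) * t / n))))) (fun n ↦ by fun_prop) ?_
    filter_upwards [hY'e, hZ'e, hsde] with ω h1 h2 h3
    have hc := hZ'c ω
    have hf : Continuous fun u ↦ y₀ + k * Z' u ω := by fun_prop
    rw [← h1 t ht, eq_of_eq_sub_mul_integral (hY'c ω) hf h3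
      ⟨t.coe_nonneg, by exact_mod_cast ht⟩, h2 t ht]
    have hR := tendsto_leftRiemannSum (f := fun u ↦ Real.exp (α * u) * (y₀ + k * Z' u ω))
      t.coe_nonneg (by fun_prop)
    refine ((hR.const_mul _).const_mul _).const_sub _ |>.congr fun n ↦ ?_
    congr 4
    refine Finset.sum_congr rfl fun i hi ↦ ?_
    have hi := Finset.mem_range.1 hi
    have hle : (i : ℝ≥0) * t / n ≤ T := by
      refine le_trans ?_ ht
      rw [div_le_iff₀ (by exact_mod_cast (by omega : 0 < n)), mul_comm]
      gcongr
    rw [← h2 _ hle]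
    push_cast
    rfl
  choose g hgm hg using hlim
  have h1 : IndepFun (fun ω (t : Set.Iic T) ↦ g t (fun u ↦ Z u ω)) (fun ω t ↦ B t ω) Q :=
    hind.symm.comp (measurable_pi_lambda _ hgm) measurable_id
  exact h1.process_congr_left hg

lemma integral_comp_eq_integral_integral_of_indepFun [IsProbabilityMeasure Q] {X : Ω → E}
    {Y : Ω → F} (hX : Measurable X) (hY : Measurable Y) (h : IndepFun X Y Q) {f : E × F → ℂ}
    (hf : Measurable f) {C : ℝ} (hC : ∀ p, ‖f p‖ ≤ C) :
    ∫ ω, f (X ω, Y ω) ∂Q = ∫ ω, ∫ ω', f (X ω, Y ω') ∂Q ∂Q := by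
  have := Measure.isProbabilityMeasure_map (μ := Q) hX.aemeasurable
  have := Measure.isProbabilityMeasure_map (μ := Q) hY.aemeasurable
  rw [← integral_map (φ := fun ω ↦ (X ω, Y ω)) (hX.prodMk hY).aemeasurable
    hf.aestronglyMeasurable,
    (indepFun_iff_map_prod_eq_prod_map_map hX.aemeasurable hY.aemeasurable).1 h,
    integral_prod _ (.of_bound hf.aestronglyMeasurable C (.of_forall hC)),
    integral_map hX.aemeasurable]
  · congr with ω
    rw [integral_map hY.aemeasurable]
    exact (hf.comp measurable_prodMk_left).aestronglyMeasurable
  · exact hf.stronglyMeasurable.integral_prod_right'.aestronglyMeasurable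

lemma charFun_map_sum_of_gaussianReal [IsProbabilityMeasure Q] {ξ : ℕ → Ω → ℝ} {h : ℝ≥0}
    (hξ : ∀ i, HasLaw (ξ i) (gaussianReal 0 h) Q) (hi : iIndepFun ξ Q) (n : ℕ) (a : ℕ → ℝ)
    (θ : ℝ) :
    charFun (Q.map fun ω ↦ ∑ i ∈ Finset.range n, a i * ξ i ω) θ =
      Complex.exp (-((h * ∑ i ∈ Finset.range n, a i ^ 2 : ℝ) * θ ^ 2 / 2)) := by
  have hi' : iIndepFun (fun i ω ↦ a i * ξ i ω) Q :=
    hi.comp (fun i x ↦ a i * x) fun i ↦ by fun_prop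
  have hm (i : ℕ) : AEMeasurable (fun ω ↦ a i * ξ i ω) Q := (hξ i).aemeasurable.const_mul _
  rw [iIndepFun.charFun_map_fun_finsetSum_eq_prod (fun i _ ↦ hm i) (hi'.restrict _),
    Finset.prod_apply, Complex.ofReal_mul, Complex.ofReal_sum]
  simp_rw [charFun_map_mul_comp (hξ _).aemeasurable, (hξ _).map_eq, charFun_gaussianReal]
  rw [← Complex.exp_sum, Finset.mul_sum, Finset.sum_mul, Finset.sum_div, ← Finset.sum_neg_distrib]
  congr 1
  refine Finset.sum_congr rfl fun i _ ↦ ?_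
  push_cast
  ring

/-- A sum of independent centered Gaussian variables, weighted by functions of an independent
variable `X` that normalise it, is standard Gaussian also after conditioning on `X`. -/
lemma setIntegral_exp_sum_of_gaussianReal [IsProbabilityMeasure Q] {X : Ω → E} (hX : Measurable X)
    {ξ : ℕ → Ω → ℝ} {h : ℝ≥0} (hξm : ∀ i, Measurable (ξ i))
    (hξ : ∀ i, HasLaw (ξ i) (gaussianReal 0 h) Q) (hi : iIndepFun ξ Q)
    (hind : IndepFun X (fun ω i ↦ ξ i ω) Q) (n : ℕ) {a : ℕ → E → ℝ} (ha : ∀ i, Measurable (a i))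
    (hnorm : ∀ x, h * ∑ i ∈ Finset.range n, a i x ^ 2 = 1) {A : Set E} (hA : MeasurableSet A)
    (θ : ℝ) :
    ∫ ω in X ⁻¹' A,
        Complex.exp (θ * (∑ i ∈ Finset.range n, a i (X ω) * ξ i ω : ℝ) * Complex.I) ∂Q =
      Q.real (X ⁻¹' A) * Complex.exp (-(θ ^ 2 / 2)) := by
  set f : E × (ℕ → ℝ) → ℂ := fun p ↦ A.indicator (fun _ ↦ (1 : ℂ)) p.1 *
    Complex.exp (θ * (∑ i ∈ Finset.range n, a i p.1 * p.2 i : ℝ) * Complex.I) with hf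
  have hfm : Measurable f := by
    have h1 : Measurable fun p : E × (ℕ → ℝ) ↦ A.indicator (fun _ ↦ (1 : ℂ)) p.1 :=
      (measurable_const.indicator hA).comp measurable_fst
    have h2 : Measurable fun p : E × (ℕ → ℝ) ↦ ∑ i ∈ Finset.range n, a i p.1 * p.2 i := by
      fun_prop
    exact h1.mul (by fun_prop)
  have hfb (p) : ‖f p‖ ≤ 1 := by
    rw [hf]
    simp only [norm_mul]
    rw [← Complex.ofReal_mul, Complex.norm_exp_ofReal_mul_I, mul_one]
    exact (norm_indicator_le_norm_self _ _).trans (by simp)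
  have hinner (x : E) : ∫ ω', f (x, fun i ↦ ξ i ω') ∂Q =
      A.indicator (fun _ ↦ (1 : ℂ)) x * Complex.exp (-(θ ^ 2 / 2)) := by
    have h1 := charFun_map_sum_of_gaussianReal hξ hi n (fun i ↦ a i x) θ
    rw [hnorm, charFun_apply_real, integral_map (by fun_prop) (by fun_prop)] at h1
    simp only [hf]
    rw [integral_const_mul, h1]
    simp
  have hmain := integral_comp_eq_integral_integral_of_indepFun hX (measurable_pi_lambda _ hξm) hind
    hfm hfb
  simp_rw [hinner] at hmain
  rw [integral_mul_const] at hmain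
  have hind1 : ∫ ω, A.indicator (fun _ ↦ (1 : ℂ)) (X ω) ∂Q = Q.real (X ⁻¹' A) := by
    have : (fun ω ↦ A.indicator (fun _ ↦ (1 : ℂ)) (X ω))
        = (X ⁻¹' A).indicator fun _ ↦ (1 : ℂ) := by
      ext ω
      rfl
    rw [this, integral_indicator_const _ (hX hA)]
    simp
  rw [hind1] at hmain
  rw [← hmain, ← integral_indicator (hX hA)]
  congr with ω
  by_cases hω : X ω ∈ A
  · rw [Set.indicator_of_mem (show ω ∈ X ⁻¹' A from hω)]
    simp [hf, hω]
  · rw [Set.indicator_of_notMem (show ω ∉ X ⁻¹' A from hω)]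
    simp [hf, hω]

/-- Being standard Gaussian and independent of `X`, expressed by characteristic functions on the
events `X ⁻¹' A`, passes to almost sure limits. -/
lemma map_prodMk_eq_prod_gaussianReal_of_tendsto [IsProbabilityMeasure Q] {X : Ω → E}
    (hX : Measurable X) {G : ℕ → Ω → ℝ} {g : Ω → ℝ} (hG : ∀ n, Measurable (G n))
    (hlim : ∀ᵐ ω ∂Q, Tendsto (fun n ↦ G n ω) atTop (𝓝 (g ω)))
    (hchar : ∀ n, ∀ A, MeasurableSet A → ∀ θ : ℝ,
      ∫ ω in X ⁻¹' A, Complex.exp (θ * (G n ω : ℝ) * Complex.I) ∂Q =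
        Q.real (X ⁻¹' A) * Complex.exp (-(θ ^ 2 / 2))) :
    Q.map (fun ω ↦ (X ω, g ω)) = (Q.map X).prod (gaussianReal 0 1) := by
  have hg : AEMeasurable g Q :=
    aemeasurable_of_tendsto_metrizable_ae atTop (fun n ↦ (hG n).aemeasurable) hlim
  have := Measure.isProbabilityMeasure_map (μ := Q) hX.aemeasurable
  have hlaw (A : Set E) (hA : MeasurableSet A) :
      (Q.restrict (X ⁻¹' A)).map g = Q (X ⁻¹' A) • gaussianReal 0 1 := by
    have hfin : IsFiniteMeasure (Q (X ⁻¹' A) • gaussianReal 0 1) :=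
      Measure.smul_finite _ (measure_ne_top _ _)
    refine Measure.ext_of_charFun (funext fun θ ↦ ?_)
    have h1 := tendsto_integral_of_dominated_convergence (μ := Q.restrict (X ⁻¹' A))
      (F := fun n ω ↦ Complex.exp (θ * (G n ω : ℝ) * Complex.I))
      (f := fun ω ↦ Complex.exp (θ * (g ω : ℝ) * Complex.I)) (fun _ ↦ 1)
      (fun n ↦ by have := hG n; fun_prop) (integrable_const _)
      (fun n ↦ .of_forall fun ω ↦ by
        rw [← Complex.ofReal_mul, Complex.norm_exp_ofReal_mul_I])
      (ae_restrict_of_ae (hlim.mono fun ω hω ↦ by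
        refine (Complex.continuous_exp.tendsto _).comp ?_
        refine Tendsto.mul_const _ (Tendsto.const_mul _ ?_)
        exact (Complex.continuous_ofReal.tendsto _).comp hω))
    simp_rw [hchar _ A hA θ] at h1
    have h2 := tendsto_nhds_unique h1 tendsto_const_nhds
    rw [charFun_apply_real, integral_map hg.restrict (by fun_prop), h2, charFun_apply_real,
      integral_smul_measure, ← charFun_apply_real, charFun_gaussianReal]
    simp [measureReal_def]
  refine (Measure.prod_eq fun A C hA hC ↦ ?_).symm
  rw [Measure.map_apply_of_aemeasurable (hX.aemeasurable.prodMk hg) (hA.prod hC),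
    Measure.map_apply hX hA]
  have h3 := congr_arg (fun μ ↦ μ C) (hlaw A hA)
  simp only [Measure.smul_apply, smul_eq_mul] at h3
  rw [Measure.map_apply_of_aemeasurable hg.restrict hC] at h3
  rw [← h3, Measure.restrict_apply₀' (hX hA).nullMeasurableSet, Set.inter_comm]
  rfl

/-- Conditionally on `X`, a call on an asset whose logarithm is Gaussian with variance `v(X)` is
priced by the Black-Scholes formula. -/
lemma condExp_callPayoff_ae_eq [IsProbabilityMeasure Q] {X : Ω → E} (hX : Measurable X)
    {g : Ω → ℝ} (hg : AEMeasurable g Q)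
    (hlaw : Q.map (fun ω ↦ (X ω, g ω)) = (Q.map X).prod (gaussianReal 0 1)) {v : E → ℝ}
    (hv : Measurable v) (hv0 : ∀ᵐ ω ∂Q, 0 < v (X ω)) {s K T : ℝ} (r : ℝ) (hs : 0 < s) (hK : 0 < K)
    (hT : 0 < T) :
    Q[fun ω ↦ callPayoff s K r T (v (X ω)) (g ω) | MeasurableSpace.comap X inferInstance] =ᵐ[Q]
      fun ω ↦ blackScholes s K r T √(1 / T * v (X ω)) := by
  have := Measure.isProbabilityMeasure_map (μ := Q) hX.aemeasurable
  have hfm : Measurable fun p : E × ℝ ↦ callPayoff s K r T (v p.1) p.2 :=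
    (measurable_callPayoff s K r T).comp ((hv.comp measurable_fst).prodMk measurable_snd)
  have hv1 : ∀ᵐ x ∂(Q.map X), 0 < v x :=
    (ae_map_iff hX.aemeasurable (measurableSet_lt measurable_const hv)).2 hv0
  have hint : Integrable (fun p : E × ℝ ↦ callPayoff s K r T (v p.1) p.2)
      (Q.map fun ω ↦ (X ω, g ω)) := by
    rw [hlaw, integrable_prod_iff hfm.aestronglyMeasurable]
    refine ⟨.of_forall fun x ↦ integrable_callPayoff r T (v x) hs hK, ?_⟩
    have hb : Integrable (fun x ↦ blackScholes s K r T √(1 / T * v x)) (Q.map X) :=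
      .of_bound (((measurable_blackScholes s K r T).comp (by fun_prop)).aestronglyMeasurable) _
        (.of_forall fun x ↦ norm_blackScholes_le s r T _ hK)
    refine hb.congr (hv1.mono fun x hx ↦ ?_)
    simp_rw [Real.norm_of_nonneg (callPayoff_nonneg ..)]
    exact (integral_callPayoff r hs hK hT hx).symm
  have hcond : condDistrib g X Q =ᵐ[Q.map X] Kernel.const E (gaussianReal 0 1) :=
    condDistrib_ae_eq_of_measure_eq_compProd X hg (by rw [hlaw, Measure.compProd_const])
  refine (condExp_prod_ae_eq_integral_condDistrib' hX hg hint).trans ?_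
  filter_upwards [ae_of_ae_map hX.aemeasurable hcond, hv0] with ω h1 h2
  rw [h1, Kernel.const_apply]
  exact integral_callPayoff r hs hK hT h2

end

/-! ### The conditional price and its discretisation -/

lemma continuous_of_abs_sq_sub_sq_le {σ : ℝ → ℝ} {c L γ : ℝ} (hc : 0 < c) (hγ : 0 < γ)
    (hσc : ∀ x, c ≤ σ x) (hσ : ∀ x y, |σ x ^ 2 - σ y ^ 2| ≤ L * |x - y| ^ γ) :
    Continuous σ := by
  have h1 : Continuous fun x ↦ σ x ^ 2 := by
    rw [continuous_iff_continuousAt]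
    intro x
    rw [ContinuousAt, tendsto_iff_norm_sub_tendsto_zero]
    refine squeeze_zero (fun _ ↦ norm_nonneg _) (fun y ↦ hσ y x) ?_
    have : Continuous fun y ↦ L * |y - x| ^ γ := by
      have := Real.continuous_rpow_const hγ.le
      fun_prop
    have h := this.tendsto x
    simpa [Real.zero_rpow hγ.ne'] using h
  have h2 : σ = fun x ↦ √(σ x ^ 2) := by
    funext x
    rw [Real.sqrt_sq (hc.le.trans (hσc x))]
  rw [h2]
  exact h1.sqrt

lemma abs_sqrt_sub_sqrt_le {a b c : ℝ} (hc : 0 < c) (ha : c ^ 2 ≤ a) (hb : c ^ 2 ≤ b) :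
    |√a - √b| ≤ 1 / (2 * c) * |a - b| := by
  have h1 : c ≤ √a := Real.le_sqrt_of_sq_le ha
  have h2 : c ≤ √b := Real.le_sqrt_of_sq_le hb
  have h3 : a - b = (√a - √b) * (√a + √b) := by
    have e1 := Real.sq_sqrt ((sq_nonneg c).trans ha)
    have e2 := Real.sq_sqrt ((sq_nonneg c).trans hb)
    linear_combination e2 - e1
  rw [h3, abs_mul, abs_of_pos (by linarith : 0 < √a + √b), one_div, inv_mul_eq_div,
    le_div_iff₀ (by positivity)]
  gcongr
  linarith

/-- Bounding `x ^ γ` affinely in `x` lets moments of order `γ` be read off from first moments. -/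
lemma rpow_le_rpow_add_rpow_sub_one_mul {x δ γ : ℝ} (hx : 0 ≤ x) (hδ : 0 < δ) (hγ0 : 0 ≤ γ)
    (hγ1 : γ ≤ 1) : x ^ γ ≤ δ ^ γ + δ ^ (γ - 1) * x := by
  rcases le_total x δ with h | h
  · have := Real.rpow_le_rpow hx h hγ0
    have : 0 ≤ δ ^ (γ - 1) * x := by positivity
    linarith
  · have hx0 : 0 < x := hδ.trans_le h
    have h1 : x ^ γ = x ^ (γ - 1) * x := by
      rw [← Real.rpow_add_one hx0.ne', sub_add_cancel]
    have h2 : x ^ (γ - 1) ≤ δ ^ (γ - 1) :=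
      Real.rpow_le_rpow_of_nonpos hδ h (by linarith)
    have h3 : 0 ≤ δ ^ γ := by positivity
    have := mul_le_mul_of_nonneg_right h2 hx
    linarith

lemma pathSigma_eq_comap {Ω : Type*} (Y : ℝ≥0 → Ω → ℝ) (T : ℝ≥0) :
    pathSigma Y T = MeasurableSpace.comap (fun ω (t : Set.Iic T) ↦ Y t ω) inferInstance := by
  simp only [pathSigma, MeasurableSpace.pi, MeasurableSpace.comap_iSup,
    MeasurableSpace.comap_comp]
  rfl

variable {Ω : Type*} [MeasurableSpace Ω] {Q : Measure Ω}

/-- The integrated variance as a limit of Riemann sums. The minimum with `T` is inert: it only makes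
every sampling time a point of `[0, T]`, also for indices outside the partition. -/
lemma tendsto_sum_integral_sq {σ : ℝ → ℝ} {x : ℝ≥0 → ℝ} {T : ℝ≥0} (hσ : Continuous σ)
    (hx : ContinuousOn x (Set.Iic T)) :
    Tendsto (fun n : ℕ ↦ (T : ℝ) / n * ∑ i ∈ Finset.range n,
      σ (x (min ((i : ℝ≥0) * T / n) T)) ^ 2) atTop
      (𝓝 (∫ u in (0 : ℝ)..T, σ (x u.toNNReal) ^ 2)) := by
  have hc : ContinuousOn (fun u : ℝ ↦ σ (x u.toNNReal) ^ 2) (Set.Icc 0 T) := by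
    refine (hσ.comp_continuousOn (hx.comp continuous_real_toNNReal.continuousOn ?_)).pow 2
    intro u hu
    exact Real.toNNReal_le_iff_le_coe.2 hu.2
  refine (tendsto_leftRiemannSum T.coe_nonneg hc).congr fun n ↦ ?_
  congr 1
  refine Finset.sum_congr rfl fun i hi ↦ ?_
  have hi := Finset.mem_range.1 hi
  have hle : (i : ℝ≥0) * T / n ≤ T := by
    rw [div_le_iff₀ (by exact_mod_cast (by omega : 0 < n)), mul_comm]
    gcongr
  rw [min_eq_left hle]
  congr 3
  rw [← Real.toNNReal_coe (r := (i : ℝ≥0) * T / n)]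
  push_cast
  rfl

lemma sq_mul_le_integral_sq {σ : ℝ → ℝ} {x : ℝ≥0 → ℝ} {T : ℝ≥0} {c : ℝ} (hc : 0 < c)
    (hσc : ∀ x, c ≤ σ x) (hσ : Continuous σ) (hx : ContinuousOn x (Set.Iic T)) :
    c ^ 2 * T ≤ ∫ u in (0 : ℝ)..T, σ (x u.toNNReal) ^ 2 := by
  have hcont : ContinuousOn (fun u : ℝ ↦ σ (x u.toNNReal) ^ 2) (Set.Icc 0 T) := by
    refine (hσ.comp_continuousOn (hx.comp continuous_real_toNNReal.continuousOn ?_)).pow 2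
    intro u hu
    exact Real.toNNReal_le_iff_le_coe.2 hu.2
  have h := intervalIntegral.integral_mono_on (μ := volume) (f := fun _ ↦ c ^ 2) T.coe_nonneg
    (by simp) (hcont.mono (by rw [Set.uIcc_of_le T.coe_nonneg])).intervalIntegrable
    fun u _ ↦ pow_le_pow_left₀ hc.le (hσc (x u.toNNReal)) 2
  simpa [mul_comm] using h

/-- The increments of a Wiener process over the uniform partition of `[0, T]`, weighted by functions
of an independent variable `X` that normalise them, add up to a standard Gaussian variable, also
after conditioning on `X`. -/
lemma setIntegral_exp_sum_increments [IsProbabilityMeasure Q] {E : Type*} [MeasurableSpace E]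
    {X : Ω → E} (hX : Measurable X) {B : ℝ≥0 → Ω → ℝ} (hBm : ∀ t, Measurable (B t))
    (hB : IsPreBrownianReal B Q) (hXB : IndepFun X (fun ω t ↦ B t ω) Q) (T : ℝ≥0) (n : ℕ)
    {a : ℕ → E → ℝ} (ha : ∀ i, Measurable (a i))
    (hnorm : ∀ x, ((T / n : ℝ≥0) : ℝ) * ∑ i ∈ Finset.range n, a i x ^ 2 = 1) {A : Set E}
    (hA : MeasurableSet A) (θ : ℝ) :
    ∫ ω in X ⁻¹' A, Complex.exp (θ * (∑ i ∈ Finset.range n, a i (X ω) *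
        (B (((i : ℝ≥0) + 1) * T / n) ω - B ((i : ℝ≥0) * T / n) ω) : ℝ) * Complex.I) ∂Q =
      Q.real (X ⁻¹' A) * Complex.exp (-(θ ^ 2 / 2)) := by
  have hlaw (i : ℕ) : HasLaw (fun ω ↦ B (((i : ℝ≥0) + 1) * T / n) ω - B ((i : ℝ≥0) * T / n) ω)
      (gaussianReal 0 (T / n)) Q := by
    have h1 := hB.hasLaw_sub (((i : ℝ≥0) + 1) * T / n) ((i : ℝ≥0) * T / n)
    have h2 : nndist ((((i : ℝ≥0) + 1) * T / n : ℝ≥0) : ℝ) (((i : ℝ≥0) * T / n : ℝ≥0) : ℝ)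
        = T / n := by
      rw [← NNReal.coe_inj, coe_nndist, Real.dist_eq]
      push_cast
      have : ((i : ℝ) + 1) * T / n - i * T / n = T / n := by ring
      rw [this, abs_of_nonneg (by positivity)]
    rw [← h2]
    exact h1
  have hmono : Monotone fun i : ℕ ↦ (i : ℝ≥0) * T / n := by
    intro i j hij
    dsimp only
    gcongr
  have hindep := hB.hasIndepIncrements.nat hmono
  simp only [Nat.cast_add, Nat.cast_one] at hindep
  have hψ : Measurable fun (b : ℝ≥0 → ℝ) (i : ℕ) ↦
      b (((i : ℝ≥0) + 1) * T / n) - b ((i : ℝ≥0) * T / n) := by fun_prop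
  have hXξ := hXB.comp measurable_id hψ
  exact setIntegral_exp_sum_of_gaussianReal hX (fun i ↦ (hBm _).sub (hBm _)) hlaw hindep hXξ n ha
    hnorm hA θ

section

variable {α k y₀ r s K c : ℝ} {T : ℝ≥0} {σ : ℝ → ℝ} {B Z Y S : ℝ≥0 → Ω → ℝ}

/-- The conditional price is the Black-Scholes price with the averaged volatility: conditionally on
the volatility path the stochastic integral `∫ σ(Y) dB` is Gaussian with variance `∫ σ²(Y) dt`. -/
theorem IsMarketModel.conditionalPrice_ae_eq [IsProbabilityMeasure Q]
    (h : IsMarketModel Q α k y₀ r s σ T B Z Y S) (hs : 0 < s) (hK : 0 < K) (hT : 0 < T)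
    (hc : 0 < c) (hσc : ∀ x, c ≤ σ x) (hσ : Continuous σ) :
    ∀ᵐ ω ∂Q, conditionalPrice Q K T Y S ω = blackScholes s K r T (avgVol σ T Y ω) := by
  have hT' : (0 : ℝ) < T := by exact_mod_cast hT
  set X : Ω → (Set.Iic T → ℝ) := fun ω t ↦ Y t ω with hXdef
  have hX : Measurable X := measurable_pi_lambda _ fun t ↦ h.volatility.measurable t
  have hXB := h.volatility.indepFun h.brownian_Z h.measurable_Z h.indep
  set V : Ω → ℝ := fun ω ↦ ∫ u in (0 : ℝ)..T, σ (Y u.toNNReal ω) ^ 2 with hV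
  set p : ℝ≥0 → (Set.Iic T → ℝ) → ℝ := fun t x ↦
    x ⟨min t T, Set.mem_Iic.2 (min_le_right _ _)⟩ with hp
  set Vn : ℕ → (Set.Iic T → ℝ) → ℝ := fun n x ↦
    (T : ℝ) / n * ∑ i ∈ Finset.range n, σ (p ((i : ℝ≥0) * T / n) x) ^ 2 with hVn
  have hσm := hσ.measurable
  have hpm (t : ℝ≥0) : Measurable (p t) := measurable_pi_apply _
  have hVnm (n : ℕ) : Measurable (Vn n) := by
    have : Measurable fun x ↦ ∑ i ∈ Finset.range n, σ (p ((i : ℝ≥0) * T / n) x) ^ 2 :=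
      Finset.measurable_sum _ fun i _ ↦ (hσm.comp (hpm _)).pow_const 2
    exact this.const_mul _
  have hVlim : ∀ᵐ ω ∂Q, Tendsto (fun n ↦ Vn n (X ω)) atTop (𝓝 (V ω)) :=
    h.volatility.continuousOn.mono fun ω hω ↦
      tendsto_sum_integral_sq (x := fun t ↦ Y t ω) hσ hω
  have hVpos : ∀ᵐ ω ∂Q, 0 < V ω :=
    h.volatility.continuousOn.mono fun ω hω ↦
      (by positivity : 0 < c ^ 2 * (T : ℝ)).trans_le
        (sq_mul_le_integral_sq (x := fun t ↦ Y t ω) hc hσc hσ hω)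
  have hVnpos (n : ℕ) (hn : 0 < n) (x) : 0 < Vn n x := by
    have hn' : (0 : ℝ) < n := by exact_mod_cast hn
    have : 0 < ∑ i ∈ Finset.range n, σ (p ((i : ℝ≥0) * T / n) x) ^ 2 :=
      Finset.sum_pos (fun i _ ↦ pow_pos (hc.trans_le (hσc _)) 2) (by simp; omega)
    simp only [hVn]
    positivity
  obtain ⟨v, hvm, hv⟩ :=
    exists_measurable_comp_eq_of_tendsto (X := X) (f := Vn) (g := V) hVnm hVlim
  obtain ⟨I, hI, hS⟩ := h.asset.solution T le_rfl
  obtain ⟨ns, hns, hR⟩ := TendstoInMeasure.exists_seq_tendsto_ae hI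
  -- shifting the subsequence by one discards the possibly empty partition
  set N : ℕ → ℕ := fun j ↦ ns (j + 1) with hN
  have hNpos (j : ℕ) : 0 < N j := (Nat.zero_lt_succ j).trans_le (hns.id_le (j + 1))
  have hNlim : Tendsto N atTop atTop := hns.tendsto_atTop.comp (tendsto_add_atTop_nat 1)
  -- `a n i` and `G j` are the weights and the stochastic Riemann sum, normalised by `√(Vn n)`
  set a : ℕ → ℕ → (Set.Iic T → ℝ) → ℝ := fun n i x ↦
    σ (p ((i : ℝ≥0) * T / n) x) / √(Vn n x) with ha
  have ham (n i : ℕ) : Measurable (a n i) := (hσm.comp (hpm _)).div (hVnm n).sqrt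
  have hnorm (n : ℕ) (hn : 0 < n) (x) :
      ((T / n : ℝ≥0) : ℝ) * ∑ i ∈ Finset.range n, a n i x ^ 2 = 1 := by
    have h0 := hVnpos n hn x
    simp only [ha, div_pow, Real.sq_sqrt h0.le]
    rw [← Finset.sum_div, ← mul_div_assoc]
    push_cast
    exact div_self h0.ne'
  set G : ℕ → Ω → ℝ := fun j ω ↦ ∑ i ∈ Finset.range (N j), a (N j) i (X ω) *
    (B (((i : ℝ≥0) + 1) * T / N j) ω - B ((i : ℝ≥0) * T / N j) ω) with hG
  have hGm (j : ℕ) : Measurable (G j) :=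
    Finset.measurable_sum _ fun i _ ↦ ((ham _ i).comp hX).mul
      ((h.measurable_B _).sub (h.measurable_B _))
  have hGlim : ∀ᵐ ω ∂Q, Tendsto (fun j ↦ G j ω) atTop (𝓝 (I ω / √(V ω))) := by
    filter_upwards [hVlim, hVpos, hR] with ω h1 h2 h3
    have h4 := (h3.comp (tendsto_add_atTop_nat 1)).div
      ((h1.comp hNlim).sqrt) (Real.sqrt_pos.2 h2).ne'
    refine h4.congr fun j ↦ ?_
    simp only [Function.comp_apply, hG, ha, Finset.sum_div, Pi.div_apply]
    refine Finset.sum_congr rfl fun i hi ↦ ?_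
    have hi := Finset.mem_range.1 hi
    have hle : (i : ℝ≥0) * T / N j ≤ T := by
      rw [div_le_iff₀ (by exact_mod_cast hNpos j), mul_comm]
      gcongr
    have h5 : p ((i : ℝ≥0) * T / N j) (X ω) = Y ((i : ℝ≥0) * T / N j) ω := by
      simp only [hp, hXdef, min_eq_left hle]
    rw [h5, div_mul_eq_mul_div]
  have hgm : AEMeasurable (fun ω ↦ I ω / √(V ω)) Q :=
    aemeasurable_of_tendsto_metrizable_ae atTop (fun j ↦ (hGm j).aemeasurable) hGlim
  have hlaw := map_prodMk_eq_prod_gaussianReal_of_tendsto hX hGm hGlim fun j A hA θ ↦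
    setIntegral_exp_sum_increments hX h.measurable_B h.brownian_B.toIsPreBrownianReal hXB T (N j)
      (ham (N j)) (hnorm (N j) (hNpos j)) hA θ
  have hprice := condExp_callPayoff_ae_eq hX hgm hlaw hvm
    (by filter_upwards [hv, hVpos] with ω h1 h2; rwa [h1]) r hs hK hT'
  have hpay : (fun ω ↦ max (S T ω - K) 0) =ᵐ[Q]
      fun ω ↦ callPayoff s K r T (v (X ω)) (I ω / √(V ω)) := by
    filter_upwards [hS, hv, hVpos] with ω h1 h2 h3
    rw [h1, h2, callPayoff, mul_div_cancel₀ _ (Real.sqrt_pos.2 h3).ne']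
  have hcond := condExp_congr_ae (m := pathSigma Y T) hpay
  rw [pathSigma_eq_comap] at hcond
  have h6 := hcond.trans hprice
  rw [← pathSigma_eq_comap] at h6
  filter_upwards [h6, hv] with ω h1 h2
  rw [conditionalPrice, h1, h2]
  rfl

/-- The averaged squared volatility and its Euler-Maruyama discretisation differ in mean by a
multiple of `(T / m) ^ (γ / 2)`. The difference is dominated by an integrable variable `W`, which
controls it also without measurability of the averaged volatility. -/
lemma IsOrnsteinUhlenbeck.exists_integrable_abs_avg_sub_le [IsProbabilityMeasure Q]
    (hY : IsOrnsteinUhlenbeck Q α k y₀ T Z Y) (hZ : IsBrownianReal Z Q)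
    (hZm : ∀ t, Measurable (Z t)) (hα : 0 ≤ α) (hk : 0 ≤ k) (hT : 0 < T) {L γ : ℝ} (hL : 0 ≤ L)
    (hγ0 : 0 ≤ γ) (hγ1 : γ ≤ 1) (hσc : Continuous σ)
    (hσ : ∀ x y, |σ x ^ 2 - σ y ^ 2| ≤ L * |x - y| ^ γ) {m : ℕ} (hm : 0 < m) :
    ∃ W : Ω → ℝ, Integrable W Q ∧
      (∀ᵐ ω ∂Q, |1 / (T : ℝ) * (∫ u in (0 : ℝ)..T, σ (Y u.toNNReal ω) ^ 2) -
        1 / (m : ℝ) * ∑ l ∈ Finset.Icc 1 m, σ (eulerOU α k y₀ T Z m l ω) ^ 2| ≤ W ω) ∧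
      ∫ ω, W ω ∂Q ≤ L * (1 + strongErrorBound α k y₀ T) * √(T / m) ^ γ := by
  obtain ⟨Y', Z', hY'm, -, hY'c, -, hY'e, -, -⟩ := hY.exists_continuous_versions hZ hZm
  have hT' : (0 : ℝ) < T := by exact_mod_cast hT
  have hm' : (0 : ℝ) < m := by exact_mod_cast hm
  have hC := strongErrorBound_nonneg (y₀ := y₀) (T := T) hα hk
  -- the order of the mean distance of the scheme from `Y`: it balances the two terms of the affine
  -- bound of `x ^ γ`
  set δ : ℝ := √(T / m) with hδ
  have hδ0 : 0 < δ := Real.sqrt_pos.2 (by positivity)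
  set t : ℕ → ℝ := fun l ↦ l * T / m with ht
  have hstep (l : ℕ) : t (l + 1) - t l = T / m := by
    simp only [ht]
    push_cast
    ring
  have hle (l : ℕ) : t l ≤ t (l + 1) := by
    have : 0 ≤ (T : ℝ) / m := by positivity
    linarith [hstep l]
  have ht0 : t 0 = 0 := by simp [ht]
  have htm : t m = T := by simp only [ht]; field_simp
  set J : ℕ → Ω → ℝ := fun l ω ↦
    ∫ u in t l..t (l + 1), |Y' u ω - eulerOU α k y₀ T Z m (l + 1) ω| with hJdef
  have hEi (l : ℕ) := integrable_eulerOU hZ.integrable_eval α k y₀ T m l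
  have hJ (l : ℕ) (hl : l < m) : Integrable (J l) Q ∧
      ∫ ω, J l ω ∂Q ≤ strongErrorBound α k y₀ T * δ * (T / m) := by
    have hu : ∀ u ∈ Set.Icc (t l) (t (l + 1)),
        Integrable (fun ω ↦ Y' u ω - eulerOU α k y₀ T Z m (l + 1) ω) Q ∧
        ∫ ω, |Y' u ω - eulerOU α k y₀ T Z m (l + 1) ω| ∂Q ≤ strongErrorBound α k y₀ T * δ := by
      intro u hu
      have hu0 : 0 ≤ u := le_trans (by simp only [ht]; positivity) hu.1
      lift u to ℝ≥0 using hu0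
      have h1 : (l : ℝ≥0) * T / m ≤ u := by exact_mod_cast hu.1
      have h2 : u ≤ ((l : ℝ≥0) + 1) * T / m := by
        have := hu.2
        simp only [ht] at this
        exact_mod_cast this
      have huT : u ≤ T := by
        refine h2.trans ?_
        rw [div_le_iff₀ (by exact_mod_cast hm), mul_comm]
        gcongr
        exact_mod_cast hl
      have hae : ∀ᵐ ω ∂Q, Y' u ω = Y u ω := hY'e.mono fun ω h ↦ h u huT
      have hYi := (hY.integrable_and_integral_abs_le hZ hZm hα hk huT).1
      refine ⟨(hYi.congr (hae.mono fun _ h ↦ h.symm)).sub (hEi _), ?_⟩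
      rw [integral_congr_ae (hae.mono fun ω h ↦ by rw [h])]
      exact hY.integral_abs_sub_eulerOU_right_le hZ hZm hα hk hl h1 h2
    have hmeas : Measurable
        (Function.uncurry fun (u : ℝ) ω ↦ Y' u ω - eulerOU α k y₀ T Z m (l + 1) ω) :=
      hY'm.sub ((measurable_eulerOU hZm α k y₀ T m (l + 1)).comp measurable_snd)
    have := integrable_and_integral_intervalIntegral_abs_le hmeas (hle l)
      (fun u h ↦ (hu u h).1) fun u h ↦ (hu u h).2
    rwa [hstep] at this
  have hsumi : Integrable (fun ω ↦ ∑ l ∈ Finset.range m, J l ω) Q :=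
    integrable_finsetSum _ fun l hl ↦ (hJ l (Finset.mem_range.1 hl)).1
  refine ⟨fun ω ↦ L * δ ^ γ + L * δ ^ (γ - 1) / T * ∑ l ∈ Finset.range m, J l ω,
    (integrable_const _).add (hsumi.const_mul _), ?_, ?_⟩
  · filter_upwards [hY'e] with ω h1
    have hc := hY'c ω
    have hcs : Continuous fun u ↦ σ (Y' u ω) ^ 2 := (hσc.comp hc).pow 2
    have hV : ∫ u in (0 : ℝ)..T, σ (Y u.toNNReal ω) ^ 2
        = ∑ l ∈ Finset.range m, ∫ u in t l..t (l + 1), σ (Y' u ω) ^ 2 := by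
      rw [intervalIntegral.sum_integral_adjacent_intervals
        (fun l _ ↦ hcs.intervalIntegrable _ _), ht0, htm]
      refine intervalIntegral.integral_congr fun u hu ↦ ?_
      rw [Set.uIcc_of_le T.coe_nonneg] at hu
      have := h1 u.toNNReal (Real.toNNReal_le_iff_le_coe.2 hu.2)
      rw [Real.coe_toNNReal _ hu.1] at this
      simp only [this]
    have hE : ∑ l ∈ Finset.Icc 1 m, σ (eulerOU α k y₀ T Z m l ω) ^ 2
        = ∑ l ∈ Finset.range m, σ (eulerOU α k y₀ T Z m (l + 1) ω) ^ 2 := by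
      rw [← Finset.Ico_add_one_right_eq_Icc, Finset.sum_Ico_eq_sum_range]
      simp [add_comm]
    have hdiff : 1 / (T : ℝ) * (∫ u in (0 : ℝ)..T, σ (Y u.toNNReal ω) ^ 2) -
        1 / (m : ℝ) * ∑ l ∈ Finset.Icc 1 m, σ (eulerOU α k y₀ T Z m l ω) ^ 2
        = 1 / (T : ℝ) * ∑ l ∈ Finset.range m, ∫ u in t l..t (l + 1),
          (σ (Y' u ω) ^ 2 - σ (eulerOU α k y₀ T Z m (l + 1) ω) ^ 2) := by
      rw [hV, hE]
      have hcell (l : ℕ) : ∫ u in t l..t (l + 1),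
          (σ (Y' u ω) ^ 2 - σ (eulerOU α k y₀ T Z m (l + 1) ω) ^ 2)
          = (∫ u in t l..t (l + 1), σ (Y' u ω) ^ 2)
            - T / m * σ (eulerOU α k y₀ T Z m (l + 1) ω) ^ 2 := by
        rw [intervalIntegral.integral_sub (hcs.intervalIntegrable _ _) (by simp),
          intervalIntegral.integral_const, hstep, smul_eq_mul]
      simp_rw [hcell]
      rw [Finset.sum_sub_distrib, ← Finset.mul_sum]
      field_simp
    have hcellb (l : ℕ) : |∫ u in t l..t (l + 1),
        (σ (Y' u ω) ^ 2 - σ (eulerOU α k y₀ T Z m (l + 1) ω) ^ 2)|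
        ≤ L * δ ^ γ * (T / m) + L * δ ^ (γ - 1) * J l ω := by
      refine (intervalIntegral.abs_integral_le_integral_abs (hle l)).trans ?_
      have hi1 : IntervalIntegrable
          (fun u ↦ |σ (Y' u ω) ^ 2 - σ (eulerOU α k y₀ T Z m (l + 1) ω) ^ 2|)
          volume (t l) (t (l + 1)) := Continuous.intervalIntegrable (by fun_prop) _ _
      have hi2 : IntervalIntegrable
          (fun u ↦ L * δ ^ (γ - 1) * |Y' u ω - eulerOU α k y₀ T Z m (l + 1) ω|)
          volume (t l) (t (l + 1)) := Continuous.intervalIntegrable (by fun_prop) _ _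
      have hmono := intervalIntegral.integral_mono_on (hle l) hi1
        (intervalIntegrable_const (c := L * δ ^ γ) |>.add hi2) fun u _ ↦ by
          refine (hσ _ _).trans ?_
          have := mul_le_mul_of_nonneg_left (rpow_le_rpow_add_rpow_sub_one_mul
            (abs_nonneg (Y' u ω - eulerOU α k y₀ T Z m (l + 1) ω)) hδ0 hγ0 hγ1) hL
          refine this.trans_eq ?_
          ring
      refine hmono.trans_eq ?_
      rw [intervalIntegral.integral_add intervalIntegrable_const hi2,
        intervalIntegral.integral_const, hstep, intervalIntegral.integral_const_mul, smul_eq_mul,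
        mul_comm ((T : ℝ) / m)]
    rw [hdiff, abs_mul, abs_of_pos (by positivity : 0 < 1 / (T : ℝ))]
    calc _ ≤ 1 / (T : ℝ) * ∑ l ∈ Finset.range m,
          (L * δ ^ γ * (T / m) + L * δ ^ (γ - 1) * J l ω) := by
          gcongr
          exact (Finset.abs_sum_le_sum_abs _ _).trans (Finset.sum_le_sum fun l _ ↦ hcellb l)
      _ = _ := by
        rw [Finset.sum_add_distrib, Finset.sum_const, Finset.card_range, nsmul_eq_mul,
          ← Finset.mul_sum]
        field_simp
  · rw [integral_add (integrable_const _) (hsumi.const_mul _),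
      integral_const_mul (L * δ ^ (γ - 1) / T),
      integral_finsetSum _ fun l hl ↦ (hJ l (Finset.mem_range.1 hl)).1]
    have hsum : ∑ l ∈ Finset.range m, ∫ ω, J l ω ∂Q ≤ strongErrorBound α k y₀ T * δ * T := by
      refine (Finset.sum_le_sum fun l hl ↦ (hJ l (Finset.mem_range.1 hl)).2).trans_eq ?_
      rw [Finset.sum_const, Finset.card_range, nsmul_eq_mul]
      field_simp
    have hδγ : δ ^ γ = δ ^ (γ - 1) * δ := by
      rw [← Real.rpow_add_one hδ0.ne', sub_add_cancel]
    calc _ ≤ L * δ ^ γ + L * δ ^ (γ - 1) / T * (strongErrorBound α k y₀ T * δ * T) := by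
          simp only [integral_const, probReal_univ, one_smul]
          gcongr
      _ = L * δ ^ γ + L * strongErrorBound α k y₀ T * (δ ^ (γ - 1) * δ) := by field_simp
      _ = _ := by
        rw [← hδγ]
        ring

end

end StochVol

theorem mainTheorem1 (α k y₀ r s K c L γ : ℝ) (T : ℝ≥0)
    (hα : 0 < α) (hk : 0 < k) (hs : 0 < s) (hK : 0 < K) (hT : 0 < T)
    (hc : 0 < c) (hL : 0 < L) (hγ0 : 0 < γ) (hγ1 : γ ≤ 1) :
    ∃ D : ℝ, 0 < D ∧
      ∀ (σ : ℝ → ℝ), (∀ x, c ≤ σ x) →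
        (∀ x y, |σ x ^ 2 - σ y ^ 2| ≤ L * |x - y| ^ γ) →
      ∀ (Ω : Type*) [MeasurableSpace Ω] (Q : Measure Ω) [IsProbabilityMeasure Q]
        (B Z Y S : ℝ≥0 → Ω → ℝ),
        StochVol.IsMarketModel Q α k y₀ r s σ T B Z Y S →
        (∀ᵐ ω ∂Q, StochVol.conditionalPrice Q K T Y S ω =
          StochVol.blackScholes s K r T (StochVol.avgVol σ T Y ω)) ∧
        ∀ m : ℕ, 1 ≤ m →
          Integrable (fun ω ↦ StochVol.conditionalPrice Q K T Y S ω -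
            StochVol.discretePrice α k y₀ r s K σ T Z m ω) Q ∧
          ∫ ω, |StochVol.conditionalPrice Q K T Y S ω -
            StochVol.discretePrice α k y₀ r s K σ T Z m ω| ∂Q ≤ D * (m : ℝ) ^ (-γ / 2) := by
  have hT' : (0 : ℝ) < T := by exact_mod_cast hT
  have hC := StochVol.strongErrorBound_nonneg (y₀ := y₀) (T := T) hα.le hk.le
  set C := StochVol.strongErrorBound α k y₀ T
  set A := Real.exp (Real.log s + r * T) * √T * (1 / (2 * c)) with hA
  have hA0 : 0 < A := by
    have := Real.sqrt_pos.2 hT'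
    positivity
  refine ⟨A * (L * (1 + C) * (T : ℝ) ^ (γ / 2)), by positivity, ?_⟩
  intro σ hσc hσ Ω _ Q _ B Z Y S h
  have hσcont := StochVol.continuous_of_abs_sq_sub_sq_le hc hγ0 hσc hσ
  have hP := h.conditionalPrice_ae_eq hs hK hT hc hσc hσcont
  refine ⟨hP, fun m hm ↦ ?_⟩
  have hm' : (0 : ℝ) < m := by exact_mod_cast hm
  have hσm := hσcont.measurable
  have hEm : Measurable (StochVol.avgVolEuler α k y₀ σ T Z m) := by
    have : Measurable fun ω ↦
        ∑ l ∈ Finset.Icc 1 m, σ (StochVol.eulerOU α k y₀ T Z m l ω) ^ 2 :=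
      Finset.measurable_sum _ fun l _ ↦
        (hσm.comp (StochVol.measurable_eulerOU h.measurable_Z α k y₀ T m l)).pow_const 2
    exact (this.const_mul _).sqrt
  have hint : Integrable (fun ω ↦ StochVol.conditionalPrice Q K T Y S ω -
      StochVol.discretePrice α k y₀ r s K σ T Z m ω) Q := by
    refine Integrable.sub integrable_condExp ?_
    exact .of_bound (((StochVol.measurable_blackScholes s K r T).comp hEm).aestronglyMeasurable) _
      (.of_forall fun ω ↦ StochVol.norm_blackScholes_le s r T _ hK)
  refine ⟨hint, ?_⟩
  obtain ⟨W, hWi, hWb, hWe⟩ := h.volatility.exists_integrable_abs_avg_sub_le h.brownian_Z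
    h.measurable_Z hα.le hk.le hT hL.le hγ0.le hγ1 hσcont hσ (m := m) hm
  have hbound : ∀ᵐ ω ∂Q, |StochVol.conditionalPrice Q K T Y S ω -
      StochVol.discretePrice α k y₀ r s K σ T Z m ω| ≤ A * W ω := by
    filter_upwards [hP, hWb, h.volatility.continuousOn] with ω h1 h2 h3
    have e1 : c ^ 2 ≤ 1 / (T : ℝ) * ∫ u in (0 : ℝ)..T, σ (Y u.toNNReal ω) ^ 2 := by
      rw [one_div, inv_mul_eq_div, le_div_iff₀ hT']
      exact StochVol.sq_mul_le_integral_sq (x := fun t ↦ Y t ω) hc hσc hσcont h3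
    have e2 : c ^ 2 ≤
        1 / (m : ℝ) * ∑ l ∈ Finset.Icc 1 m, σ (StochVol.eulerOU α k y₀ T Z m l ω) ^ 2 := by
      rw [one_div, inv_mul_eq_div, le_div_iff₀ hm']
      have := Finset.card_nsmul_le_sum (Finset.Icc 1 m)
        (fun l ↦ σ (StochVol.eulerOU α k y₀ T Z m l ω) ^ 2) (c ^ 2)
        fun l _ ↦ pow_le_pow_left₀ hc.le (hσc _) 2
      simpa [mul_comm] using this
    have hc2 : 0 < c ^ 2 := by positivity
    rw [h1, StochVol.discretePrice]
    refine (StochVol.abs_blackScholes_sub_le s r hK hT' (Real.sqrt_pos.2 (hc2.trans_le e1))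
      (Real.sqrt_pos.2 (hc2.trans_le e2))).trans ?_
    rw [hA, mul_assoc _ (1 / (2 * c))]
    gcongr
    exact (StochVol.abs_sqrt_sub_sqrt_le hc e1 e2).trans (by gcongr)
  have hrate : √((T : ℝ) / m) ^ γ = (T : ℝ) ^ (γ / 2) * (m : ℝ) ^ (-γ / 2) := by
    rw [Real.sqrt_eq_rpow, ← Real.rpow_mul (by positivity), Real.div_rpow hT'.le hm'.le,
      neg_div, Real.rpow_neg hm'.le, div_eq_mul_inv, one_div_mul_eq_div]
  calc _ ≤ ∫ ω, A * W ω ∂Q := integral_mono_ae hint.abs (hWi.const_mul A) hbound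
    _ = A * ∫ ω, W ω ∂Q := integral_const_mul _ _
    _ ≤ A * (L * (1 + C) * √(T / m) ^ γ) := by gcongr
    _ = _ := by
      rw [hrate]
      ring
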